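/- **Setting.** Let $(\Omega,\mathcal F,\mathbb P)$ be a probability space and $\sigma:\Omega\to\Omega$ an ergodic $\mathbb P$-preserving map. Let $M$ be a metric space with Borel $\sigma$-algebra $\mathcal B(M)$ and let $M_\omega\subset M$ ($\omega\in\Omega$) be closed sets with $\mathcal M:=\{(\omega,x):x\in M_\omega\}\in\mathcal F\otimes\mathcal B(M)$. Let $T_\omega:M_\omega\to M_{\sigma\omega}$ be maps such that $(\omega,x)\mapsto T_\omega(x)$ is measurable on $\mathcal M$, and let $\mu_\omega$ be Borel probability measures on $M_\omega$ such that $\omega\mapsto\mu_\omega(\{x:(\omega,x)\in\mathcal C\})$ is measurable for every measurable $\mathcal C\subset\mathcal M$ and $(T_\omega)_*\mu_\omega=\mu_{\sigma\omega}$ for $\mathbb P$-a.e. $\omega$. Put $T_\omega^n=T_{\sigma^{n-1}\omega}\circ\cdots\circ T_\omega$. Let $L_\omega$ be the transfer operator of $T_\omega$, i.e. $L_\omega g$ is the density with respect to $\mu_{\sigma\omega}$ of $(T_\omega)_*(g\mu_\omega)$, so that $\int_{M_\omega} g\cdot(f\circ T_\omega)\,d\mu_\omega=\int_{M_{\sigma\omega}}(L_\omega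 g)f\,d\mu_{\sigma\omega}$ for bounded measurable $g,f$, and put $L_\omega^n=L_{\sigma^{n-1}\omega}\circ\cdots\circ L_\omega$. Write $[g]_\omega=g-\int g\,d\mu_\omega$ and $\|g\|_{\mathrm{Lip}}=\sup|g|+\sup_{x\ne y}\frac{|g(x)-g(y)|}{d(x,y)}$ for functions on a fibre. **Loss of memory.** Let $s\ge1$ and $p>0$ be real numbers. Assume that there are a random variable $K\in L^p(\Omega,\mathcal F,\mathbb P)$ and a decreasing sequence $(a_n)_{n\ge0}$ of positive numbers converging to $0$ such that for $\mathbb P$-a.e. $\omega$, all integers $0\le l\le i\le j$ and all $g_1:M_{\sigma^l\omega}\to\mathbb R$, $g_2:M_{\sigma^i\omega}\to\mathbb R$ of finite Lipschitz norm, $$\Bigl\|\bigl[L_{\sigma^i\omega}^{j-i}\bigl(g_2\,L_{\sigma^l\omega}^{i-l}g_1\bigr)\bigr]_{\sigma^j\omega}\Bigr\|_{L^s(\mu_{\sigma^j\omega})}\le K(\sigma^i\omega)\,a_{j-i}\,(1+\|g_1\|_{\mathrm{Lip}})(1+\|g_2\|_{\mathrm{Lip}}).$$ **Theorem.** Let $\varphi:\mathcal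 M\to\mathbb R$ be measurable, $\varphi_\omega=\varphi(\omega,\cdot)$, such that for $\mathbb P$-a.e. $\omega$ one has $\int_{M_\omega}\varphi_\omega\,d\mu_\omega=0$ and $\|\varphi_\omega\|_{\mathrm{Lip}}<\infty$, and such that $\omega\mapsto\|\varphi_\omega\|_{\mathrm{Lip}}$ belongs to $L^r(\Omega,\mathcal F,\mathbb P)$ for some real $r>0$. Suppose that $$\frac1p+\frac1r\le\frac12\qquad\text{and}\qquad\sum_{n=1}^\infty a_n<\infty .$$ Let $S_n^\omega\varphi=\sum_{k=0}^{n-1}\varphi_{\sigma^k\omega}\circ T_\omega^k$. Then there is a number $\Sigma^2\ge0$, not depending on $\omega$, such that for $\mathbb P$-a.e. $\omega$ all $S_n^\omega\varphi$ are square integrable with respect to $\mu_\omega$ and $$\lim_{n\to\infty}\frac1n\int_{M_\omega}(S_n^\omega\varphi)^2\,d\mu_\omega=\Sigma^2 .$$ Moreover, for $\mathbb P$-a.e. $\omega$, the random variables $n^{-1/2}S_n^\omega\varphi$ on $(M_\omega,\mu_\omega)$ converge in distribution to $\mathcal N(0,\Sigma^2)$, the normal law with mean $0$ and variance $\Sigma^2$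 if $\Sigma^2>0$, and the unit mass at $0$ if $\Sigma^2=0$. -/

import Mathlib

open MeasureTheory ProbabilityTheory Filter Topology
open scoped ENNReal NNReal

noncomputable section

namespace RandomCLT

/-- A random dynamical system over the ergodic probability-preserving system `(Ω, P, σ)`, whose
fibres `fiber ω` are closed subsets of a metric space `M`.
The fibre maps `T ω : fiber ω → fiber (σ ω)` and the measures `μ ω` on `fiber ω` are written as a
map `M → M` (whose values off `fiber ω` play no role) and as a measure on `M` carried by
`fiber ω`. That `μ` is a `Kernel` says that `ω ↦ μ ω B` is measurable for every Borel set `B`,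
equivalently that `ω ↦ μ ω {x | (ω, x) ∈ C}` is measurable for every measurable `C`. -/
structure RandomSystem (Ω M : Type*) [MeasurableSpace Ω] [MetricSpace M] [MeasurableSpace M]
    [BorelSpace M] (P : Measure Ω) where
  /-- the base transformation -/
  σ : Ω → Ω
  ergodic : Ergodic σ P
  /-- the random closed sets -/
  fiber : Ω → Set M
  isClosed_fiber : ∀ ω, IsClosed (fiber ω)
  measurableSet_total : MeasurableSet {z : Ω × M | z.2 ∈ fiber z.1}
  /-- the fibre maps -/
  T : Ω → M → M
  mapsTo : ∀ ω, Set.MapsTo (T ω) (fiber ω) (fiber (σ ω))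
  measurable_T : Measurable fun z : {z : Ω × M | z.2 ∈ fiber z.1} => T z.1.1 z.1.2
  /-- the equivariant measures -/
  μ : Kernel Ω M
  isMarkov : IsMarkovKernel μ
  measure_compl_fiber : ∀ ω, μ ω (fiber ω)ᶜ = 0
  equivariant : ∀ᵐ ω ∂P, (μ ω).map (T ω) = μ (σ ω)

/-- The transfer operator of `T : (M, μ) → (M, ν)`: the density with respect to `ν` of the image
under `T` of the signed measure `g μ` (positive part minus negative part). -/
def transferOperator {M : Type*} [MeasurableSpace M] (T : M → M) (μ ν : Measure M) (g : M → ℝ) :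
    M → ℝ := fun x =>
  (((μ.withDensity fun y => ENNReal.ofReal (g y)).map T).rnDeriv ν x).toReal
    - (((μ.withDensity fun y => ENNReal.ofReal (-g y)).map T).rnDeriv ν x).toReal

/-- The Lipschitz norm `sup |g| + Lip(g)` of `g` restricted to the set `F`; it is finite exactly
for the functions that are bounded and Lipschitz on `F`. -/
def lipNorm {M : Type*} [MetricSpace M] (F : Set M) (g : M → ℝ) : ℝ≥0∞ :=
  (⨆ x ∈ F, ‖g x‖ₑ) + ⨆ x ∈ F, ⨆ y ∈ F, edist (g x) (g y) / edist x y

namespace RandomSystem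

variable {Ω M : Type*} [MeasurableSpace Ω] [MetricSpace M] [MeasurableSpace M] [BorelSpace M]
  {P : Measure Ω}

instance (D : RandomSystem Ω M P) : IsMarkovKernel D.μ := D.isMarkov

/-- `𝓜 = {(ω, x) : x ∈ M_ω}`. -/
def total (D : RandomSystem Ω M P) : Set (Ω × M) := {z | z.2 ∈ D.fiber z.1}

/-- `T_ω^n = T_{σ^{n-1} ω} ∘ ⋯ ∘ T_{σ ω} ∘ T_ω`. -/
def iterT (D : RandomSystem Ω M P) (ω : Ω) : ℕ → M → M
  | 0 => id
  | n + 1 => D.T (D.σ^[n] ω) ∘ D.iterT ω n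

/-- `L_ω`, the transfer operator of `T_ω` with respect to `μ_ω` and `μ_{σ ω}`. -/
def L (D : RandomSystem Ω M P) (ω : Ω) (g : M → ℝ) : M → ℝ :=
  transferOperator (D.T ω) (D.μ ω) (D.μ (D.σ ω)) g

/-- `L_ω^n = L_{σ^{n-1} ω} ∘ ⋯ ∘ L_{σ ω} ∘ L_ω`. -/
def iterL (D : RandomSystem Ω M P) (ω : Ω) : ℕ → (M → ℝ) → (M → ℝ)
  | 0 => id
  | n + 1 => D.L (D.σ^[n] ω) ∘ D.iterL ω n

/-- `[g]_ω = g - ∫ g dμ_ω`. -/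
def center (D : RandomSystem Ω M P) (ω : Ω) (g : M → ℝ) : M → ℝ :=
  fun x => g x - ∫ y, g y ∂(D.μ ω)

/-- The Birkhoff sum `S_n^ω φ = ∑_{k < n} φ_{σ^k ω} ∘ T_ω^k`. -/
def birkhoff (D : RandomSystem Ω M P) (φ : Ω → M → ℝ) (ω : Ω) (n : ℕ) (x : M) : ℝ :=
  ∑ k ∈ Finset.range n, φ (D.σ^[k] ω) (D.iterT ω k x)

/-- Quenched loss of memory in `L^s`, with random constant `K ∈ L^p` and rate `a`. -/
structure MemoryLoss (D : RandomSystem Ω M P) (s p : ℝ) (K : Ω → ℝ) (a : ℕ → ℝ) : Prop where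
  memLp : MemLp K (ENNReal.ofReal p) P
  pos : ∀ n, 0 < a n
  antitone : Antitone a
  tendsto : Tendsto a atTop (𝓝 0)
  bound : ∀ᵐ ω ∂P, ∀ l i j : ℕ, l ≤ i → i ≤ j → ∀ g₁ g₂ : M → ℝ,
    lipNorm (D.fiber (D.σ^[l] ω)) g₁ ≠ ∞ → lipNorm (D.fiber (D.σ^[i] ω)) g₂ ≠ ∞ →
    eLpNorm
        (D.center (D.σ^[j] ω)
          (D.iterL (D.σ^[i] ω) (j - i) (fun x => g₂ x * D.iterL (D.σ^[l] ω) (i - l) g₁ x)))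
        (ENNReal.ofReal s) (D.μ (D.σ^[j] ω))
      ≤ ENNReal.ofReal (K (D.σ^[i] ω) * a (j - i)
          * (1 + (lipNorm (D.fiber (D.σ^[l] ω)) g₁).toReal)
          * (1 + (lipNorm (D.fiber (D.σ^[i] ω)) g₂).toReal))

end RandomSystem

end RandomCLT

end

/-! Fix a typical `ω` and put X_k = φ_{σ^k ω} ∘ T_ω^k on (M_ω, μ_ω). Duality between the transfer
operators and composition turns memory loss into decorrelation from the future: a bounded function
of T_ω^j x has covariance with X_l X_i, for l ≤ i ≤ j, of order a_{j-i}
(`MemoryLossAt.norm_sub_le`). Functions of T_ω^j x are measurable for σ-algebras that decrease in j.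
This structure, `Decorrelated`, is all that the probabilistic argument uses.

The characteristic function is peeled from the past. Let h_k be the expectation of the tail
exponential exp(iu ∑_{k≤j<n} X_j). Expanding h_k - h_{k+1} leaves a first order term iu E[X_k
tail_{k+1}]. Since E X_k = 0, telescoping the tail down to 1 rewrites it through second order terms
E[X_k X_j tail_{j+1}] (`norm_increment_le`). A gap of length m between X_j and the tail separates
these into E[X_k X_j] h_{k+1} (`norm_decouple_le`). So h_k ≈ (1 - x_k) h_{k+1} with ∑ x_k = u²
E[S_n²] / 2, and a discrete Gronwall estimate gives h_0 ≈ exp(-u² E[S_n²] / 2)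
(`norm_charFun_sub_le`).

Put N = 1 + ‖φ‖_Lip and A = 2|K|N. For u = t/√n the errors vanish once the sums of N² and A² along
the orbit are O(n) and the largest terms are o(n). Both follow from Birkhoff's theorem, because
Hölder and 1/p + 1/r ≤ 1/2 put N and A in L². Birkhoff's theorem also averages the correlation at
each lag; it is dominated by a_d, so summation over the lags passes to the limit and gives the same
Σ² for almost every `ω`. -/

noncomputable section

namespace RandomCLT

/-! ### Pointwise ergodic theorem, through running maxima of Birkhoff sums. -/

section Birkhoff

variable {Ω : Type*}

/-- The running maximum `max_{1 ≤ k ≤ n + 1} S_k f` of the Birkhoff sums of `f`. -/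
def birkhoffMax (σ : Ω → Ω) (f : Ω → ℝ) : ℕ → Ω → ℝ
  | 0 => f
  | n + 1 => fun x => f x + max 0 (birkhoffMax σ f n (σ x))

lemma birkhoffMax_le_succ (σ : Ω → Ω) (f : Ω → ℝ) (n : ℕ) (x : Ω) :
    birkhoffMax σ f n x ≤ birkhoffMax σ f (n + 1) x := by
  induction n generalizing x with
  | zero => simp [birkhoffMax]
  | succ n ih =>
    have h := ih (σ x)
    change f x + max 0 (birkhoffMax σ f n (σ x)) ≤ f x + max 0 (birkhoffMax σ f (n + 1) (σ x))
    gcongr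

lemma birkhoffMax_monotone (σ : Ω → Ω) (f : Ω → ℝ) (x : Ω) :
    Monotone fun n => birkhoffMax σ f n x :=
  monotone_nat_of_le_succ fun n => birkhoffMax_le_succ σ f n x

lemma birkhoffSum_le_birkhoffMax (σ : Ω → Ω) (f : Ω → ℝ) (n : ℕ) (x : Ω) :
    birkhoffSum σ f (n + 1) x ≤ birkhoffMax σ f n x := by
  induction n generalizing x with
  | zero => simp [birkhoffMax]
  | succ n ih =>
    rw [birkhoffSum_succ']
    have h := ih (σ x)
    change _ ≤ f x + max 0 (birkhoffMax σ f n (σ x))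
    gcongr
    exact h.trans (le_max_right _ _)

/-- The recursion changes the maximum along the orbit only by the finite amount `f x`. The set where
the maxima stay bounded is therefore strictly invariant, and ergodicity applies to it. -/
lemma bddAbove_birkhoffMax_comp_iff (σ : Ω → Ω) (f : Ω → ℝ) (x : Ω) :
    BddAbove (Set.range fun n => birkhoffMax σ f n (σ x)) ↔
      BddAbove (Set.range fun n => birkhoffMax σ f n x) := by
  constructor
  · rintro ⟨C, hC⟩
    refine ⟨f x + max 0 C, ?_⟩
    rintro _ ⟨n, rfl⟩
    refine (birkhoffMax_le_succ σ f n x).trans ?_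
    change f x + max 0 (birkhoffMax σ f n (σ x)) ≤ _
    have : birkhoffMax σ f n (σ x) ≤ C := hC ⟨n, rfl⟩
    gcongr
  · rintro ⟨C, hC⟩
    refine ⟨C - f x, ?_⟩
    rintro _ ⟨n, rfl⟩
    have h1 : f x + max 0 (birkhoffMax σ f n (σ x)) ≤ C := hC ⟨n + 1, rfl⟩
    have h2 := le_max_right 0 (birkhoffMax σ f n (σ x))
    change birkhoffMax σ f n (σ x) ≤ _
    linarith

variable [MeasurableSpace Ω] {P : Measure Ω}

lemma measurable_birkhoffMax {σ : Ω → Ω} {f : Ω → ℝ} (hσ : Measurable σ) (hf : Measurable f)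
    (n : ℕ) : Measurable (birkhoffMax σ f n) := by
  induction n with
  | zero => exact hf
  | succ n ih => exact hf.add (measurable_const.max (ih.comp hσ))

lemma integrable_birkhoffMax {σ : Ω → Ω} {f : Ω → ℝ} (hσ : MeasurePreserving σ P P)
    (hf : Integrable f P) (n : ℕ) : Integrable (birkhoffMax σ f n) P := by
  induction n with
  | zero => exact hf
  | succ n ih =>
    have h := hσ.integrable_comp_of_integrable ih
    refine hf.add ?_
    have := (h.pos_part)
    simpa [max_comm] using this

/-- The Birkhoff sums of a function with negative mean are bounded above. -/
lemma ae_bddAbove_birkhoffMax [IsProbabilityMeasure P] {σ : Ω → Ω} {f : Ω → ℝ}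
    (hσ : Ergodic σ P) (hfm : Measurable f) (hf : Integrable f P) (hneg : ∫ x, f x ∂P < 0) :
    ∀ᵐ x ∂P, BddAbove (Set.range fun n => birkhoffMax σ f n x) := by
  set A : Set Ω := {x | BddAbove (Set.range fun n => birkhoffMax σ f n x)} with hA
  have hAm : MeasurableSet A :=
    measurableSet_bddAbove_range fun n => measurable_birkhoffMax hσ.measurable hfm n
  have hinv : σ ⁻¹' A = A := by
    ext x
    exact bddAbove_birkhoffMax_comp_iff σ f x
  rcases hσ.toPreErgodic.ae_mem_or_ae_notMem hAm hinv with h | h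
  · exact h
  exfalso
  have hmp := hσ.toMeasurePreserving
  -- If the maxima M_n are a.e. unbounded, then M_n ∘ σ → ∞, so M_{n+1} - M_n ∘ σ = f + (M_n ∘ σ)⁻
  -- tends to f, dominated by |f| + |f ∘ σ|. Its integral is ∫ (M_{n+1} - M_n) ≥ 0 by invariance of
  -- `P`, which forces ∫ f ≥ 0.
  have hlim : Tendsto (fun n => ∫ x, (f x + max (-birkhoffMax σ f n (σ x)) 0) ∂P) atTop
      (𝓝 (∫ x, f x ∂P)) := by
    refine tendsto_integral_of_dominated_convergence (fun x => |f x| + |f (σ x)|) ?_ ?_ ?_ ?_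
    · intro n
      exact (hfm.add ((((measurable_birkhoffMax hσ.measurable hfm n).comp
        hσ.measurable).neg).max measurable_const)).aestronglyMeasurable
    · exact hf.abs.add (hmp.integrable_comp_of_integrable hf).abs
    · intro n
      refine ae_of_all _ fun x => ?_
      have h1 : f (σ x) ≤ birkhoffMax σ f n (σ x) :=
        birkhoffMax_monotone σ f (σ x) (Nat.zero_le n)
      have h2 : max (-birkhoffMax σ f n (σ x)) 0 ≤ |f (σ x)| :=
        max_le (by linarith [neg_abs_le (f (σ x))]) (abs_nonneg _)
      rw [Real.norm_eq_abs]
      refine (abs_add_le _ _).trans ?_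
      rw [abs_of_nonneg (le_max_right (-birkhoffMax σ f n (σ x)) 0)]
      linarith
    · filter_upwards [h] with x hx
      have hx' : ¬ BddAbove (Set.range fun n => birkhoffMax σ f n (σ x)) := by
        rw [bddAbove_birkhoffMax_comp_iff]
        exact hx
      have ht : Tendsto (fun n => birkhoffMax σ f n (σ x)) atTop atTop :=
        (tendsto_atTop_atTop_of_monotone (birkhoffMax_monotone σ f (σ x))) fun b => by
          by_contra! hcon
          exact hx' ⟨b, by rintro _ ⟨n, rfl⟩; exact (hcon n).le⟩
      refine tendsto_const_nhds.congr' ?_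
      filter_upwards [ht.eventually_ge_atTop 0] with n hn
      rw [max_eq_right (by linarith), add_zero]
  have hge : ∀ n, 0 ≤ ∫ x, (f x + max (-birkhoffMax σ f n (σ x)) 0) ∂P := by
    intro n
    have hi := integrable_birkhoffMax hmp hf n
    have hi' := integrable_birkhoffMax hmp hf (n + 1)
    have e : (fun x => f x + max (-birkhoffMax σ f n (σ x)) 0)
        = fun x => birkhoffMax σ f (n + 1) x - birkhoffMax σ f n (σ x) := by
      ext x
      change _ = f x + max 0 (birkhoffMax σ f n (σ x)) - _
      rcases le_total 0 (birkhoffMax σ f n (σ x)) with h | h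
      · rw [max_eq_right (by linarith), max_eq_right h]; ring
      · rw [max_eq_left (by linarith), max_eq_left h]; ring
    have e2 : ∫ x, birkhoffMax σ f n (σ x) ∂P = ∫ x, birkhoffMax σ f n x ∂P := by
      have := integral_map (μ := P) (φ := σ) hσ.measurable.aemeasurable
        (f := birkhoffMax σ f n)
        (measurable_birkhoffMax hσ.measurable hfm n).aestronglyMeasurable
      rw [hmp.map_eq] at this
      exact this.symm
    have hc : Integrable (fun x => birkhoffMax σ f n (σ x)) P :=
      hmp.integrable_comp_of_integrable hi
    rw [e, integral_sub hi' hc, e2, sub_nonneg]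
    exact integral_mono hi hi' fun x => birkhoffMax_le_succ σ f n x
  have := ge_of_tendsto' hlim hge
  linarith

/-- Subtracting a constant halfway between the mean and mean + ε makes the mean negative. The
centred sums are then bounded above, and the bound disappears after division by n. -/
lemma ae_eventually_birkhoffSum_le [IsProbabilityMeasure P] {σ : Ω → Ω} {f : Ω → ℝ}
    (hσ : Ergodic σ P) (hfm : Measurable f) (hf : Integrable f P) {ε : ℝ} (hε : 0 < ε) :
    ∀ᵐ x ∂P, ∀ᶠ n : ℕ in atTop, birkhoffSum σ f n x / n ≤ ∫ y, f y ∂P + ε := by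
  set c := ∫ y, f y ∂P + ε / 2 with hc
  have hg : Integrable (fun x => f x - c) P := hf.sub (integrable_const c)
  have hneg : ∫ x, (f x - c) ∂P < 0 := by
    rw [integral_sub hf (integrable_const c)]
    simp [hc]; linarith
  filter_upwards [ae_bddAbove_birkhoffMax hσ (hfm.sub_const c) hg hneg] with x hx
  obtain ⟨C, hC⟩ := hx
  have hlim : Tendsto (fun n : ℕ => C / (n : ℝ)) atTop (𝓝 0) :=
    tendsto_const_div_atTop_nhds_zero_nat C
  filter_upwards [hlim.eventually_le_const (half_pos hε), eventually_ge_atTop 1] with n hn hn1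
  have hb : birkhoffSum σ (fun x => f x - c) n x ≤ C := by
    obtain ⟨m, rfl⟩ := Nat.exists_eq_add_of_le' hn1
    exact (birkhoffSum_le_birkhoffMax _ _ m x).trans (hC ⟨m, rfl⟩)
  have hs : birkhoffSum σ (fun x => f x - c) n x = birkhoffSum σ f n x - n * c := by
    simp [birkhoffSum, Finset.sum_sub_distrib]
  have hn0 : (0 : ℝ) < n := by exact_mod_cast hn1
  rw [div_le_iff₀ hn0] at hn ⊢
  rw [hs] at hb
  nlinarith

/-- Birkhoff's pointwise ergodic theorem for an ergodic transformation. -/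
theorem tendsto_birkhoffSum_div [IsProbabilityMeasure P] {σ : Ω → Ω} {f : Ω → ℝ}
    (hσ : Ergodic σ P) (hf : Integrable f P) :
    ∀ᵐ x ∂P, Tendsto (fun n : ℕ => birkhoffSum σ f n x / n) atTop (𝓝 (∫ y, f y ∂P)) := by
  wlog hfm : Measurable f generalizing f
  · have h := this (f := hf.aestronglyMeasurable.mk f) (hf.congr hf.aestronglyMeasurable.ae_eq_mk)
      hf.aestronglyMeasurable.stronglyMeasurable_mk.measurable
    have h2 : ∀ᵐ x ∂P, ∀ n,
        birkhoffSum σ f n x = birkhoffSum σ (hf.aestronglyMeasurable.mk f) n x :=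
      ae_all_iff.2 fun n =>
        hσ.toMeasurePreserving.quasiMeasurePreserving.birkhoffSum_ae_eq_of_ae_eq
          hf.aestronglyMeasurable.ae_eq_mk n
    filter_upwards [h, h2] with x hx hx2
    simp_rw [hx2, integral_congr_ae hf.aestronglyMeasurable.ae_eq_mk]
    exact hx
  have h1 : ∀ᵐ x ∂P, ∀ k : ℕ, ∀ᶠ n : ℕ in atTop,
      birkhoffSum σ f n x / n ≤ ∫ y, f y ∂P + 1 / ((k : ℝ) + 1) :=
    ae_all_iff.2 fun k => ae_eventually_birkhoffSum_le hσ hfm hf Nat.one_div_pos_of_nat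
  have h2 : ∀ᵐ x ∂P, ∀ k : ℕ, ∀ᶠ n : ℕ in atTop,
      birkhoffSum σ (-f) n x / n ≤ ∫ y, (-f) y ∂P + 1 / ((k : ℝ) + 1) :=
    ae_all_iff.2 fun k => ae_eventually_birkhoffSum_le hσ hfm.neg hf.neg Nat.one_div_pos_of_nat
  filter_upwards [h1, h2] with x hx1 hx2
  rw [Metric.tendsto_nhds]
  intro ε hε
  obtain ⟨k, hk⟩ := exists_nat_one_div_lt hε
  filter_upwards [hx1 k, hx2 k] with n hn1 hn2
  have e : ∫ y, (-f) y ∂P = -∫ y, f y ∂P := integral_neg f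
  rw [birkhoffSum_neg, e, neg_div] at hn2
  rw [Real.dist_eq, abs_lt]
  constructor <;> linarith

/-- x_n / n is the difference of consecutive averages, up to the factor (n + 1) / n. Applied to N²
and A², it shows that no single term of the orbit dominates. -/
lemma tendsto_div_of_tendsto_sum_div {x : ℕ → ℝ} {c : ℝ}
    (h : Tendsto (fun n : ℕ => (∑ k ∈ Finset.range n, x k) / n) atTop (𝓝 c)) :
    Tendsto (fun n : ℕ => x n / n) atTop (𝓝 0) := by
  have h1 := h.comp (tendsto_add_atTop_nat 1)
  have h2 : Tendsto (fun n : ℕ => 1 + 1 / (n : ℝ)) atTop (𝓝 (1 + 0)) :=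
    tendsto_const_nhds.add tendsto_one_div_atTop_nhds_zero_nat
  have h3 := (h1.mul h2).sub h
  rw [add_zero, mul_one, sub_self] at h3
  refine h3.congr' ?_
  filter_upwards [eventually_ge_atTop 1] with n hn
  have hn0 : (n : ℝ) ≠ 0 := by positivity
  simp only [Function.comp, Finset.sum_range_succ]
  push_cast
  field_simp
  ring

end Birkhoff

/-! ### Weighted double sums, discrete Gronwall and Taylor bounds for the exponential. -/

section Sequences

lemma sum_range_sum_Ico {E : Type*} [AddCommMonoid E] (n : ℕ) (F : ℕ → ℕ → E) :
    ∑ k ∈ Finset.range n, ∑ j ∈ Finset.Ico k n, F k j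
      = ∑ d ∈ Finset.range n, ∑ k ∈ Finset.range (n - d), F k (k + d) := by
  rw [Finset.sum_sigma', Finset.sum_sigma']
  refine Finset.sum_nbij' (fun z => ⟨z.2 - z.1, z.1⟩) (fun z => ⟨z.2, z.2 + z.1⟩) ?_ ?_ ?_ ?_ ?_
  · rintro ⟨k, j⟩ h
    simp only [Finset.mem_sigma, Finset.mem_range, Finset.mem_Ico] at h ⊢
    omega
  · rintro ⟨k, j⟩ h
    simp only [Finset.mem_sigma, Finset.mem_range, Finset.mem_Ico] at h ⊢
    omega
  · rintro ⟨k, j⟩ h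
    simp only [Finset.mem_sigma, Finset.mem_range, Finset.mem_Ico] at h
    have : k + (j - k) = j := by omega
    simp [this]
  · rintro ⟨k, j⟩ h
    simp
  · rintro ⟨k, j⟩ h
    simp only [Finset.mem_sigma, Finset.mem_range, Finset.mem_Ico] at h
    have : k + (j - k) = j := by omega
    simp [this]

lemma sum_mul_shift_le {n d : ℕ} {x y : ℕ → ℝ} {B : ℝ}
    (hx2 : ∑ k ∈ Finset.range n, x k ^ 2 ≤ B) (hy2 : ∑ k ∈ Finset.range n, y k ^ 2 ≤ B) :
    ∑ k ∈ Finset.range (n - d), x k * y (k + d) ≤ B := by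
  have h1 : ∑ k ∈ Finset.range (n - d), x k ^ 2 ≤ B :=
    (Finset.sum_le_sum_of_subset_of_nonneg (Finset.range_mono (Nat.sub_le n d))
      fun _ _ _ => sq_nonneg _).trans hx2
  have h2 : ∑ k ∈ Finset.range (n - d), y (k + d) ^ 2 ≤ B := by
    refine le_trans ?_ hy2
    rw [Finset.range_eq_Ico, Finset.sum_Ico_add' (fun k => y k ^ 2)]
    refine Finset.sum_le_sum_of_subset_of_nonneg ?_ fun _ _ _ => sq_nonneg _
    intro k hk
    simp only [Finset.mem_Ico, Finset.mem_range] at hk ⊢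
    omega
  have h3 : ∑ k ∈ Finset.range (n - d), x k * y (k + d)
      ≤ ∑ k ∈ Finset.range (n - d), (x k ^ 2 + y (k + d) ^ 2) / 2 :=
    Finset.sum_le_sum fun k _ => by nlinarith [sq_nonneg (x k - y (k + d))]
  rw [← Finset.sum_div, Finset.sum_add_distrib] at h3
  linarith

/-- Young's inequality in discrete form: sum first along each lag d = j - k, where xy ≤ (x² + y²) /
2 gives the bound B whatever the shift. -/
lemma sum_sum_weight_mul_le {n : ℕ} {x y w : ℕ → ℝ} {B : ℝ} (hw : ∀ d, 0 ≤ w d)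
    (hx2 : ∑ k ∈ Finset.range n, x k ^ 2 ≤ B) (hy2 : ∑ k ∈ Finset.range n, y k ^ 2 ≤ B) :
    ∑ k ∈ Finset.range n, ∑ j ∈ Finset.Ico k n, w (j - k) * (x k * y j)
      ≤ (∑ d ∈ Finset.range n, w d) * B := by
  rw [sum_range_sum_Ico, Finset.sum_mul]
  refine Finset.sum_le_sum fun d _ => ?_
  simp only [Nat.add_sub_cancel_left, ← Finset.mul_sum]
  exact mul_le_mul_of_nonneg_left (sum_mul_shift_le hx2 hy2) (hw d)

/-- A discrete Gronwall estimate: an approximate solution of `h k = (1 - x k) h (k + 1)` with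
terminal value `1` is close to `exp (- ∑ x)`. -/
lemma norm_sub_exp_neg_sum_le {n : ℕ} {h : ℕ → ℂ} {x β : ℕ → ℝ}
    (hn : h n = 1) (h1 : ∀ k, ‖h k‖ ≤ 1) (hx : ∀ k < n, |x k| ≤ β k) (hβ : ∀ k < n, β k ≤ 1) :
    ‖h 0 - Real.exp (-∑ k ∈ Finset.range n, x k)‖
      ≤ Real.exp (∑ k ∈ Finset.range n, β k)
        * ∑ k ∈ Finset.range n, (‖h k - h (k + 1) + x k * h (k + 1)‖ + β k ^ 2) := by
  -- The value is known only at the terminal index, so the induction runs backwards from n.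
  have key : ∀ m ≤ n, ‖h (n - m) - Real.exp (-∑ k ∈ Finset.Ico (n - m) n, x k)‖
      ≤ Real.exp (∑ k ∈ Finset.Ico (n - m) n, β k)
        * ∑ k ∈ Finset.Ico (n - m) n, (‖h k - h (k + 1) + x k * h (k + 1)‖ + β k ^ 2) := by
    intro m
    induction m with
    | zero => intro _; simp [hn]
    | succ m ih =>
      intro hm
      have ih := ih (by omega)
      set k := n - (m + 1) with hk
      have hkm : n - m = k + 1 := by omega
      have hkn : k < n := by omega
      rw [hkm] at ih
      rw [Finset.sum_eq_sum_Ico_succ_bot hkn, Finset.sum_eq_sum_Ico_succ_bot hkn,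
        Finset.sum_eq_sum_Ico_succ_bot hkn]
      set X := ∑ i ∈ Finset.Ico (k + 1) n, x i
      set B := ∑ i ∈ Finset.Ico (k + 1) n, β i
      set Z := ∑ i ∈ Finset.Ico (k + 1) n, (‖h i - h (i + 1) + x i * h (i + 1)‖ + β i ^ 2)
      have hβ0 : 0 ≤ β k := (abs_nonneg _).trans (hx k hkn)
      have hB0 : 0 ≤ B := Finset.sum_nonneg fun i hi =>
        (abs_nonneg _).trans (hx i (Finset.mem_Ico.1 hi).2)
      have hZ0 : 0 ≤ Z := Finset.sum_nonneg fun i _ => by positivity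
      -- Three errors: the defect of the recursion at k, the replacement of 1 - x by exp(-x), and
      -- the error already made at k + 1.
      have e : h k - Real.exp (-(x k + X))
          = (h k - h (k + 1) + x k * h (k + 1))
            + -((Real.exp (-x k) - 1 - (-x k) : ℝ) : ℂ) * h (k + 1)
            + Real.exp (-x k) * (h (k + 1) - Real.exp (-X)) := by
        rw [neg_add, Real.exp_add]
        push_cast
        ring
      have hx1 : |(-x k)| ≤ 1 := by rw [abs_neg]; exact (hx k hkn).trans (hβ k hkn)
      have hq : |Real.exp (-x k) - 1 - (-x k)| ≤ β k ^ 2 := by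
        refine (Real.abs_exp_sub_one_sub_id_le hx1).trans ?_
        rw [neg_sq, ← sq_abs]
        exact pow_le_pow_left₀ (abs_nonneg _) (hx k hkn) 2
      have hexp : Real.exp (-x k) ≤ Real.exp (β k) :=
        Real.exp_le_exp.2 ((neg_le_abs _).trans (hx k hkn))
      have hone : 1 ≤ Real.exp (β k + B) := Real.one_le_exp (by positivity)
      calc ‖h k - Real.exp (-(x k + X))‖
          ≤ ‖h k - h (k + 1) + x k * h (k + 1)‖ + β k ^ 2 * 1
              + Real.exp (β k) * (Real.exp B * Z) := by
            rw [e]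
            refine (norm_add₃_le).trans ?_
            rw [norm_mul, norm_mul, norm_neg, Complex.norm_real, Complex.norm_real,
              Real.norm_eq_abs, Real.norm_eq_abs, abs_of_pos (Real.exp_pos _)]
            gcongr
            exact h1 _
        _ ≤ _ := by
            rw [← mul_assoc, ← Real.exp_add, mul_one, mul_add]
            have : 0 ≤ ‖h k - h (k + 1) + x k * h (k + 1)‖ + β k ^ 2 := by positivity
            nlinarith
  have := key n le_rfl
  simp only [Nat.sub_self, ← Finset.range_eq_Ico] at this
  exact this

lemma norm_exp_I_mul_sub_le {θ : ℝ} (hθ : |θ| ≤ 1) :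
    ‖Complex.exp (Complex.I * θ) - 1 - Complex.I * θ‖ ≤ θ ^ 2 := by
  have h : ‖Complex.I * (θ : ℂ)‖ = |θ| := by simp
  have := Complex.norm_exp_sub_one_sub_id_le (x := Complex.I * θ) (by rwa [h])
  rwa [h, sq_abs] at this

lemma norm_exp_I_mul_sub_le' {θ : ℝ} (hθ : |θ| ≤ 1) :
    ‖Complex.exp (Complex.I * θ) - 1 - Complex.I * θ + θ ^ 2 / 2‖ ≤ |θ| ^ 3 := by
  have h : ‖Complex.I * (θ : ℂ)‖ = |θ| := by simp
  have := Complex.exp_bound (x := Complex.I * θ) (by rwa [h]) (n := 3) (by norm_num)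
  rw [h] at this
  have e : Complex.exp (Complex.I * θ) - 1 - Complex.I * θ + θ ^ 2 / 2
      = Complex.exp (Complex.I * θ)
        - ∑ m ∈ Finset.range 3, (Complex.I * (θ : ℂ)) ^ m / (m.factorial : ℂ) := by
    simp [Finset.sum_range_succ, mul_pow]
    ring
  rw [e]
  refine this.trans ?_
  norm_num [Nat.factorial]
  nlinarith [pow_nonneg (abs_nonneg θ) 3]

end Sequences

/-! ### Decorrelated sequences and the expansion of the characteristic function. -/

/-- A sequence of bounded centred random variables `X k`, measurable with respect to decreasing
σ-algebras `ℱ k`, whose first and second order products decorrelate from `ℱ j` as `j → ∞`. -/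
structure Decorrelated {S : Type*} [m0 : MeasurableSpace S] (μ : Measure S) (X : ℕ → S → ℝ)
    (ℱ : ℕ → MeasurableSpace S) (N A a : ℕ → ℝ) : Prop where
  le : ∀ k, ℱ k ≤ m0
  anti : Antitone ℱ
  meas : ∀ k, Measurable[ℱ k] (X k)
  bound : ∀ k ω, |X k ω| ≤ N k
  A_nonneg : ∀ k, 0 ≤ A k
  a_nonneg : ∀ d, 0 ≤ a d
  a_anti : Antitone a
  mean : ∀ k, ∫ ω, X k ω ∂μ = 0
  decay : ∀ k j, k ≤ j → ∀ g : S → ℂ, Measurable[ℱ j] g → ∀ C : ℝ, (∀ ω, ‖g ω‖ ≤ C) →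
    ‖∫ ω, (X k ω : ℂ) * g ω ∂μ‖ ≤ A k * a (j - k) * C
  cov : ∀ l i j, l ≤ i → i ≤ j → ∀ g : S → ℂ, Measurable[ℱ j] g → ∀ C : ℝ, (∀ ω, ‖g ω‖ ≤ C) →
    ‖∫ ω, (X l ω : ℂ) * X i ω * g ω ∂μ - (∫ ω, X l ω * X i ω ∂μ : ℝ) * ∫ ω, g ω ∂μ‖
      ≤ N l * A i * a (j - i) * C

/-- `exp (i u ∑_{k ≤ j < n} X j)`. -/
def tailExp {S : Type*} (X : ℕ → S → ℝ) (u : ℝ) (n k : ℕ) (ω : S) : ℂ :=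
  Complex.exp (Complex.I * (u * ∑ j ∈ Finset.Ico k n, X j ω : ℝ))

section

variable {S : Type*} {X : ℕ → S → ℝ} {u : ℝ} {n k : ℕ} {ω : S}

lemma norm_tailExp : ‖tailExp X u n k ω‖ = 1 := by
  rw [tailExp, mul_comm, Complex.norm_exp_ofReal_mul_I]

lemma tailExp_self : tailExp X u n n ω = 1 := by
  simp [tailExp]

lemma tailExp_eq_mul (hk : k < n) :
    tailExp X u n k ω = tailExp X u n (k + 1) ω * Complex.exp (Complex.I * (u * X k ω : ℝ)) := by
  rw [tailExp, tailExp, ← Complex.exp_add, Finset.sum_eq_sum_Ico_succ_bot hk]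
  congr 1
  push_cast
  ring

lemma norm_tailExp_sub_le {N : ℕ → ℝ} {ε : ℝ} (hX : ∀ k ω, |X k ω| ≤ N k)
    (hε : ∀ k < n, |u| * N k ≤ ε) {q : ℕ} (hkq : k ≤ q) (hqn : q ≤ n) :
    ‖tailExp X u n k ω - tailExp X u n q ω‖ ≤ (q - k : ℕ) * ε := by
  have e : tailExp X u n k ω - tailExp X u n q ω = tailExp X u n q ω
      * (Complex.exp (Complex.I * (u * ∑ j ∈ Finset.Ico k q, X j ω : ℝ)) - 1) := by
    rw [mul_sub, mul_one, tailExp, tailExp, ← Complex.exp_add,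
      ← Finset.sum_Ico_consecutive _ hkq hqn]
    congr 2
    push_cast
    ring
  rw [e, norm_mul, norm_tailExp, one_mul]
  refine Real.norm_exp_I_mul_ofReal_sub_one_le.trans ?_
  rw [Real.norm_eq_abs, abs_mul]
  calc |u| * |∑ j ∈ Finset.Ico k q, X j ω|
      ≤ |u| * ∑ j ∈ Finset.Ico k q, N j := by
        gcongr
        exact (Finset.abs_sum_le_sum_abs _ _).trans (Finset.sum_le_sum fun j _ => hX j ω)
    _ = ∑ j ∈ Finset.Ico k q, |u| * N j := Finset.mul_sum _ _ _
    _ ≤ ∑ j ∈ Finset.Ico k q, ε :=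
        Finset.sum_le_sum fun j hj => hε j ((Finset.mem_Ico.1 hj).2.trans_le hqn)
    _ = _ := by simp

end

namespace Decorrelated

variable {S : Type*} [m0 : MeasurableSpace S] {μ : Measure S} [IsProbabilityMeasure μ]
  {X : ℕ → S → ℝ} {ℱ : ℕ → MeasurableSpace S} {N A a : ℕ → ℝ} {u : ℝ} {n : ℕ}

section
omit [IsProbabilityMeasure μ]

lemma meas_le (H : Decorrelated μ X ℱ N A a) {j k : ℕ} (h : j ≤ k) : Measurable[ℱ j] (X k) :=
  (H.meas k).mono (H.anti h) le_rfl

lemma measurable (H : Decorrelated μ X ℱ N A a) (k : ℕ) : Measurable (X k) :=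
  (H.meas k).mono (H.le k) le_rfl

lemma meas_tailExp (H : Decorrelated μ X ℱ N A a) {j k : ℕ} (h : j ≤ k) :
    Measurable[ℱ j] (tailExp X u n k) := by
  have h1 : Measurable[ℱ j] fun ω => ∑ i ∈ Finset.Ico k n, X i ω :=
    @Finset.measurable_fun_sum _ _ _ _ _ _ (ℱ j) _ _
      fun i hi => H.meas_le (h.trans (Finset.mem_Ico.1 hi).1)
  exact (by fun_prop : Measurable fun x : ℝ => Complex.exp (Complex.I * (u * x : ℝ))).comp h1

lemma measurable_tailExp (H : Decorrelated μ X ℱ N A a) (k : ℕ) : Measurable (tailExp X u n k) :=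
  (H.meas_tailExp le_rfl).mono (H.le k) le_rfl

lemma N_nonneg (H : Decorrelated μ X ℱ N A a) [Nonempty S] (k : ℕ) : 0 ≤ N k :=
  (abs_nonneg _).trans (H.bound k (Classical.arbitrary S))

end

lemma integrable_of_bdd {g : S → ℂ} (hg : Measurable g) {C : ℝ} (h : ∀ ω, ‖g ω‖ ≤ C) :
    Integrable g μ :=
  Integrable.of_bound hg.aestronglyMeasurable C (ae_of_all _ h)

lemma integrable_mul (H : Decorrelated μ X ℱ N A a) (k : ℕ) {g : S → ℂ} (hg : Measurable g)
    {C : ℝ} (h : ∀ ω, ‖g ω‖ ≤ C) : Integrable (fun ω => (X k ω : ℂ) * g ω) μ := by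
  refine integrable_of_bdd (C := N k * C)
    ((Complex.measurable_ofReal.comp (H.measurable k)).mul hg) fun ω => ?_
  rw [norm_mul, Complex.norm_real]
  exact mul_le_mul (H.bound k ω) (h ω) (norm_nonneg _) ((abs_nonneg _).trans (H.bound k ω))

lemma integrable_tailExp (H : Decorrelated μ X ℱ N A a) (k : ℕ) :
    Integrable (tailExp X u n k) μ :=
  integrable_of_bdd (H.measurable_tailExp k) fun _ => norm_tailExp.le

-- The product of X_j and g is itself a function measurable for `ℱ j`, bounded by N_j C, so it is an
-- admissible test function for `decay`.
omit [IsProbabilityMeasure μ] in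
lemma decay₂ (H : Decorrelated μ X ℱ N A a) {k j : ℕ} (hkj : k ≤ j) {g : S → ℂ}
    (hg : Measurable[ℱ j] g) {C : ℝ} (h : ∀ ω, ‖g ω‖ ≤ C) :
    ‖∫ ω, (X k ω : ℂ) * X j ω * g ω ∂μ‖ ≤ a (j - k) * (A k * N j) * C := by
  simp_rw [mul_assoc (X k _ : ℂ)]
  refine (H.decay k j hkj (fun ω => (X j ω : ℂ) * g ω) ?_ (N j * C) fun ω => ?_).trans_eq
    (by ring)
  · exact (Complex.measurable_ofReal.comp (H.meas j)).mul hg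
  · rw [norm_mul, Complex.norm_real]
    exact mul_le_mul (H.bound j ω) (h ω) (norm_nonneg _) ((abs_nonneg _).trans (H.bound j ω))

omit [IsProbabilityMeasure μ] in
lemma abs_integral_mul_le (H : Decorrelated μ X ℱ N A a) {k j : ℕ} (hkj : k ≤ j) :
    |∫ ω, X k ω * X j ω ∂μ| ≤ a (j - k) * (A k * N j) := by
  have h := H.decay₂ hkj (g := fun _ => 1) measurable_const (C := 1) (by simp)
  have e : ∫ ω, (X k ω : ℂ) * X j ω * 1 ∂μ = ((∫ ω, X k ω * X j ω ∂μ : ℝ) : ℂ) := by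
    rw [← integral_complex_ofReal]
    simp
  rwa [e, Complex.norm_real, mul_one] at h

/-- The first step of the expansion of the characteristic function. -/
lemma norm_taylor_le (H : Decorrelated μ X ℱ N A a) {ε : ℝ} (hε1 : ε ≤ 1)
    (hε : ∀ k < n, |u| * N k ≤ ε) {k : ℕ} (hk : k < n) :
    ‖(∫ ω, tailExp X u n k ω ∂μ) - (∫ ω, tailExp X u n (k + 1) ω ∂μ)
        - (Complex.I * u * (∫ ω, (X k ω : ℂ) * tailExp X u n (k + 1) ω ∂μ)
          - u ^ 2 / 2 * ∫ ω, (X k ω : ℂ) * X k ω * tailExp X u n (k + 1) ω ∂μ)‖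
      ≤ u ^ 2 * ε * N k ^ 2 := by
  have i1 := H.integrable_tailExp (u := u) (n := n) k
  have i2 := H.integrable_tailExp (u := u) (n := n) (k + 1)
  have i3 := H.integrable_mul k (H.measurable_tailExp (u := u) (n := n) (k + 1))
    (C := 1) fun _ => norm_tailExp.le
  have i4 : Integrable (fun ω => (X k ω : ℂ) * X k ω * tailExp X u n (k + 1) ω) μ := by
    simp_rw [mul_assoc]
    refine H.integrable_mul k ((Complex.measurable_ofReal.comp (H.measurable k)).mul
      (H.measurable_tailExp (u := u) (n := n) (k + 1))) (C := N k) fun ω => ?_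
    rw [norm_mul, norm_tailExp, mul_one]
    exact (Complex.norm_real _).trans_le (H.bound k ω)
  have i5 : Integrable (fun ω => tailExp X u n k ω - tailExp X u n (k + 1) ω) μ := i1.sub i2
  have i6 : Integrable (fun ω => Complex.I * u * ((X k ω : ℂ) * tailExp X u n (k + 1) ω)
      - u ^ 2 / 2 * ((X k ω : ℂ) * X k ω * tailExp X u n (k + 1) ω)) μ :=
    (i3.const_mul _).sub (i4.const_mul _)
  rw [← integral_sub i1 i2, ← integral_const_mul, ← integral_const_mul,
    ← integral_sub (i3.const_mul _) (i4.const_mul _), ← integral_sub i5 i6]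
  refine (norm_integral_le_of_norm_le_const (C := u ^ 2 * ε * N k ^ 2)
    (ae_of_all _ fun ω => ?_)).trans_eq (by simp)
  have hb : |u * X k ω| ≤ |u| * N k := by
    rw [abs_mul]; exact mul_le_mul_of_nonneg_left (H.bound k ω) (abs_nonneg _)
  have hN : 0 ≤ N k := (abs_nonneg _).trans (H.bound k ω)
  have e : tailExp X u n k ω - tailExp X u n (k + 1) ω
      - (Complex.I * u * ((X k ω : ℂ) * tailExp X u n (k + 1) ω)
        - u ^ 2 / 2 * ((X k ω : ℂ) * X k ω * tailExp X u n (k + 1) ω))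
      = tailExp X u n (k + 1) ω * (Complex.exp (Complex.I * (u * X k ω : ℝ)) - 1
        - Complex.I * (u * X k ω : ℝ) + (u * X k ω : ℝ) ^ 2 / 2) := by
    rw [tailExp_eq_mul hk]
    push_cast
    ring
  rw [e, norm_mul, norm_tailExp, one_mul]
  refine (norm_exp_I_mul_sub_le' (hb.trans ((hε k hk).trans hε1))).trans ?_
  -- One of the three factors |u| N_k of the cubic remainder is traded for ε, so that only N_k² has
  -- to be summed.
  calc |u * X k ω| ^ 3 ≤ (|u| * N k) ^ 3 := by gcongr
    _ = |u| ^ 2 * (|u| * N k) * N k ^ 2 := by ring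
    _ ≤ |u| ^ 2 * ε * N k ^ 2 := by gcongr; exact hε k hk
    _ = _ := by rw [sq_abs]

/-- The first order term, expanded by telescoping. -/
lemma norm_telescope_le (H : Decorrelated μ X ℱ N A a) {ε : ℝ} (hε1 : ε ≤ 1)
    (hε : ∀ k < n, |u| * N k ≤ ε) {k : ℕ} (hk : k < n) :
    ‖(∫ ω, (X k ω : ℂ) * tailExp X u n (k + 1) ω ∂μ)
        - ∑ j ∈ Finset.Ico (k + 1) n,
          Complex.I * u * ∫ ω, (X k ω : ℂ) * X j ω * tailExp X u n (j + 1) ω ∂μ‖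
      ≤ ∑ j ∈ Finset.Ico (k + 1) n, |u| * ε * (a (j - k) * (A k * N j)) := by
  have i1 : ∀ j, Integrable (fun ω => (X k ω : ℂ) * tailExp X u n j ω) μ := fun j =>
    H.integrable_mul k (H.measurable_tailExp j) (C := 1) fun _ => norm_tailExp.le
  have i2 : ∀ j, Integrable (fun ω => (X k ω : ℂ) * X j ω * tailExp X u n (j + 1) ω) μ := by
    intro j
    simp_rw [mul_assoc]
    refine H.integrable_mul k ((Complex.measurable_ofReal.comp (H.measurable j)).mul
      (H.measurable_tailExp (u := u) (n := n) (j + 1))) (C := N j) fun ω => ?_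
    rw [norm_mul, norm_tailExp, mul_one]
    exact (Complex.norm_real _).trans_le (H.bound j ω)
  -- The telescoping has no boundary term: the empty tail is 1 and X_k is centred.
  have h0 : ∫ ω, (X k ω : ℂ) * tailExp X u n n ω ∂μ = 0 := by
    simp only [tailExp_self, mul_one]
    rw [integral_complex_ofReal, H.mean k, Complex.ofReal_zero]
  have e : (∫ ω, (X k ω : ℂ) * tailExp X u n (k + 1) ω ∂μ)
      = ∑ j ∈ Finset.Ico (k + 1) n, ((∫ ω, (X k ω : ℂ) * tailExp X u n j ω ∂μ)
        - ∫ ω, (X k ω : ℂ) * tailExp X u n (j + 1) ω ∂μ) := by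
    have := Finset.sum_Ico_sub (fun j => ∫ ω, (X k ω : ℂ) * tailExp X u n j ω ∂μ) (Nat.succ_le_of_lt hk)
    rw [h0, zero_sub] at this
    rw [← neg_eq_iff_eq_neg.2 this, ← Finset.sum_neg_distrib]
    exact Finset.sum_congr rfl fun j _ => by ring
  rw [e, ← Finset.sum_sub_distrib]
  refine norm_sum_le_of_le _ fun j hj => ?_
  obtain ⟨hkj, hjn⟩ := Finset.mem_Ico.1 hj
  have i3 : Integrable (fun ω => (X k ω : ℂ) * tailExp X u n j ω
      - (X k ω : ℂ) * tailExp X u n (j + 1) ω) μ := (i1 j).sub (i1 (j + 1))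
  rw [← integral_const_mul, ← integral_sub (i1 j) (i1 (j + 1)),
    ← integral_sub i3 ((i2 j).const_mul _)]
  -- The second order remainder of exp(iu X_j), times the later tail. It depends only on the future
  -- from j on, so `decay` still yields the factor a_{j-k}.
  set η : S → ℂ := fun ω => tailExp X u n (j + 1) ω *
    (Complex.exp (Complex.I * (u * X j ω : ℝ)) - 1 - Complex.I * (u * X j ω : ℝ)) with hη
  have e2 : ∀ ω, (X k ω : ℂ) * tailExp X u n j ω - (X k ω : ℂ) * tailExp X u n (j + 1) ω
      - Complex.I * u * ((X k ω : ℂ) * X j ω * tailExp X u n (j + 1) ω) = (X k ω : ℂ) * η ω := by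
    intro ω
    rw [hη, tailExp_eq_mul hjn]
    push_cast
    ring
  simp only [e2]
  have hηm : Measurable[ℱ j] η :=
    (H.meas_tailExp (Nat.le_succ j)).mul ((by fun_prop : Measurable fun x : ℝ =>
      Complex.exp (Complex.I * (u * x : ℝ)) - 1 - Complex.I * (u * x : ℝ)).comp (H.meas j))
  refine (H.decay k j (by omega) η hηm (|u| * ε * N j) fun ω => ?_).trans_eq (by ring)
  have hb : |u * X j ω| ≤ |u| * N j := by
    rw [abs_mul]; exact mul_le_mul_of_nonneg_left (H.bound j ω) (abs_nonneg _)
  have hN : 0 ≤ N j := (abs_nonneg _).trans (H.bound j ω)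
  rw [hη, norm_mul, norm_tailExp, one_mul]
  refine (norm_exp_I_mul_sub_le (hb.trans ((hε j hjn).trans hε1))).trans ?_
  calc (u * X j ω) ^ 2 = |u * X j ω| ^ 2 := (sq_abs _).symm
    _ ≤ (|u| * N j) ^ 2 := by gcongr
    _ = |u| * (|u| * N j) * N j := by ring
    _ ≤ _ := by gcongr; exact hε j hjn

end Decorrelated

/-- The weight `1 / 2` on the diagonal and `1` off it. -/
def diagHalf (k j : ℕ) : ℝ := if j = k then 1 / 2 else 1

lemma diagHalf_nonneg (k j : ℕ) : 0 ≤ diagHalf k j := by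
  unfold diagHalf; split_ifs <;> norm_num

lemma diagHalf_le_one (k j : ℕ) : diagHalf k j ≤ 1 := by
  unfold diagHalf; split_ifs <;> norm_num

/-- The ordered pairs k ≤ j, with the diagonal halved, make up half of the square. This matches the
second order Taylor coefficient 1/2 at j = k and identifies the total exponent with half the
variance. -/
lemma sum_diagHalf_mul (x : ℕ → ℝ) (n : ℕ) :
    ∑ k ∈ Finset.range n, ∑ j ∈ Finset.Ico k n, diagHalf k j * (x k * x j)
      = (∑ k ∈ Finset.range n, x k) ^ 2 / 2 := by
  induction n with
  | zero => simp
  | succ n ih =>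
    have h1 : ∀ k ∈ Finset.range n, ∑ j ∈ Finset.Ico k (n + 1), diagHalf k j * (x k * x j)
        = ∑ j ∈ Finset.Ico k n, diagHalf k j * (x k * x j) + x k * x n := by
      intro k hk
      have hk := Finset.mem_range.1 hk
      rw [Finset.sum_Ico_succ_top hk.le, diagHalf, if_neg hk.ne', one_mul]
    rw [Finset.sum_range_succ, Finset.sum_congr rfl h1, Finset.sum_add_distrib, ih,
      Finset.sum_range_succ, ← Finset.sum_mul]
    simp [diagHalf]
    ring

namespace Decorrelated

variable {S : Type*} [m0 : MeasurableSpace S] {μ : Measure S} [IsProbabilityMeasure μ]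
  {X : ℕ → S → ℝ} {ℱ : ℕ → MeasurableSpace S} {N A a : ℕ → ℝ} {u : ℝ} {n : ℕ}

/-- Second order expansion of one increment of the characteristic function. -/
lemma norm_increment_le (H : Decorrelated μ X ℱ N A a) {ε : ℝ} (hε1 : ε ≤ 1)
    (hε : ∀ k < n, |u| * N k ≤ ε) {k : ℕ} (hk : k < n) :
    ‖(∫ ω, tailExp X u n k ω ∂μ) - (∫ ω, tailExp X u n (k + 1) ω ∂μ)
        + u ^ 2 * ∑ j ∈ Finset.Ico k n,
          (diagHalf k j : ℂ) * ∫ ω, (X k ω : ℂ) * X j ω * tailExp X u n (j + 1) ω ∂μ‖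
      ≤ u ^ 2 * ε * N k ^ 2 + ∑ j ∈ Finset.Ico (k + 1) n, u ^ 2 * ε * (a (j - k) * (A k * N j)) := by
  have h1 := H.norm_taylor_le hε1 hε hk
  have h2 := H.norm_telescope_le hε1 hε hk
  have h3 : ∑ j ∈ Finset.Ico k n,
      (diagHalf k j : ℂ) * ∫ ω, (X k ω : ℂ) * X j ω * tailExp X u n (j + 1) ω ∂μ
      = 1 / 2 * (∫ ω, (X k ω : ℂ) * X k ω * tailExp X u n (k + 1) ω ∂μ)
        + ∑ j ∈ Finset.Ico (k + 1) n, ∫ ω, (X k ω : ℂ) * X j ω * tailExp X u n (j + 1) ω ∂μ := by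
    rw [Finset.sum_eq_sum_Ico_succ_bot hk]
    congr 1
    · simp [diagHalf]
    · refine Finset.sum_congr rfl fun j hj => ?_
      have hj := (Finset.mem_Ico.1 hj).1
      rw [diagHalf, if_neg (by omega), Complex.ofReal_one, one_mul]
  rw [h3]
  rw [← Finset.mul_sum] at h2
  set E0 := ∫ ω, tailExp X u n k ω ∂μ
  set E1 := ∫ ω, tailExp X u n (k + 1) ω ∂μ
  set E2 := ∫ ω, (X k ω : ℂ) * tailExp X u n (k + 1) ω ∂μ
  set E3 := ∫ ω, (X k ω : ℂ) * X k ω * tailExp X u n (k + 1) ω ∂μ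
  set E4 := ∑ j ∈ Finset.Ico (k + 1) n, ∫ ω, (X k ω : ℂ) * X j ω * tailExp X u n (j + 1) ω ∂μ
  have e : E0 - E1 + u ^ 2 * (1 / 2 * E3 + E4)
      = (E0 - E1 - (Complex.I * u * E2 - u ^ 2 / 2 * E3))
        + Complex.I * u * (E2 - Complex.I * u * E4) := by
    linear_combination ((u : ℂ) ^ 2 * E4) * Complex.I_sq
  rw [e]
  refine (norm_add_le _ _).trans (add_le_add h1 ?_)
  rw [norm_mul, norm_mul, Complex.norm_I, one_mul, Complex.norm_real, Real.norm_eq_abs]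
  refine (mul_le_mul_of_nonneg_left h2 (abs_nonneg _)).trans_eq ?_
  rw [Finset.mul_sum]
  refine Finset.sum_congr rfl fun j _ => ?_
  rw [← sq_abs u]
  ring

/-- Decoupling of `X k * X j` from the tail. -/
lemma norm_decouple_le (H : Decorrelated μ X ℱ N A a) {ε : ℝ} (hε0 : 0 ≤ ε)
    (hε : ∀ k < n, |u| * N k ≤ ε) (D m : ℕ) {k j : ℕ} (hkj : k ≤ j) (hj : j < n) :
    ‖(∫ ω, (X k ω : ℂ) * X j ω * tailExp X u n (j + 1) ω ∂μ)
        - (∫ ω, X k ω * X j ω ∂μ : ℝ) * ∫ ω, tailExp X u n (k + 1) ω ∂μ‖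
      ≤ (if j - k < D then a (j - k) * ((2 * m + D) * ε) else 2 * a (j - k)) * (A k * N j)
        + (if j - k < D then a m else 0) * (N k * A j) := by
  have : Nonempty S := nonempty_of_isProbabilityMeasure μ
  have hA := H.A_nonneg
  have ha := H.a_nonneg
  have hN := H.N_nonneg
  have hE : ∀ i, ‖∫ ω, tailExp X u n i ω ∂μ‖ ≤ 1 := fun i =>
    (norm_integral_le_of_norm_le_const (C := 1) (ae_of_all _ fun ω => norm_tailExp.le)).trans_eq
      (by simp)
  have hc : ‖((∫ ω, X k ω * X j ω ∂μ : ℝ) : ℂ)‖ ≤ a (j - k) * (A k * N j) :=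
    (Complex.norm_real _).trans_le (H.abs_integral_mul_le hkj)
  by_cases hd : j - k < D
  · rw [if_pos hd, if_pos hd]
    -- The tail is restarted at q, at cost mε; X_k X_j is separated from it across the gap; then its
    -- mean is moved back from q to k + 1, at cost (m + D)ε. The prefactor a_{j-k} A_k N_j
    -- accompanies both moves.
    set q := min (j + 1 + m) n with hq
    have i1 : ∀ i, Integrable (fun ω => (X k ω : ℂ) * X j ω * tailExp X u n i ω) μ := by
      intro i
      simp_rw [mul_assoc]
      refine H.integrable_mul k ((Complex.measurable_ofReal.comp (H.measurable j)).mul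
        (H.measurable_tailExp (u := u) (n := n) i)) (C := N j) fun ω => ?_
      rw [norm_mul, norm_tailExp, mul_one]
      exact (Complex.norm_real _).trans_le (H.bound j ω)
    have t1 : ‖(∫ ω, (X k ω : ℂ) * X j ω * tailExp X u n (j + 1) ω ∂μ)
        - ∫ ω, (X k ω : ℂ) * X j ω * tailExp X u n q ω ∂μ‖
        ≤ a (j - k) * (A k * N j) * (m * ε) := by
      rw [← integral_sub (i1 _) (i1 _)]
      simp_rw [← mul_sub]
      refine H.decay₂ hkj ((H.meas_tailExp (by omega)).sub (H.meas_tailExp (by omega)))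
        fun ω => ?_
      refine (norm_tailExp_sub_le H.bound hε (by omega) (by omega)).trans ?_
      gcongr
      omega
    have t2 : ‖(∫ ω, (X k ω : ℂ) * X j ω * tailExp X u n q ω ∂μ)
        - (∫ ω, X k ω * X j ω ∂μ : ℝ) * ∫ ω, tailExp X u n q ω ∂μ‖ ≤ a m * (N k * A j) := by
      rcases le_total (j + 1 + m) n with h | h
      · have hq' : q = j + 1 + m := min_eq_left h
        refine (H.cov k j q hkj (by omega) _ (H.meas_tailExp le_rfl) 1
          fun ω => norm_tailExp.le).trans ?_
        have : a (q - j) ≤ a m := H.a_anti (by omega)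
        have h2 : 0 ≤ N k * A j := mul_nonneg (hN k) (hA j)
        nlinarith
      -- There is no room for a gap, but the restarted tail is 1 and the factorization is exact.
      · have hq' : q = n := min_eq_right h
        rw [hq']
        simp only [tailExp_self, mul_one]
        have : ∫ ω, (X k ω : ℂ) * X j ω ∂μ = ((∫ ω, X k ω * X j ω ∂μ : ℝ) : ℂ) := by
          rw [← integral_complex_ofReal]; simp
        rw [this]
        simp only [integral_const, probReal_univ, one_smul, mul_one, sub_self, norm_zero]
        exact mul_nonneg (ha m) (mul_nonneg (hN k) (hA j))
    have t3 : ‖((∫ ω, X k ω * X j ω ∂μ : ℝ) : ℂ) * (∫ ω, tailExp X u n q ω ∂μ)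
        - (∫ ω, X k ω * X j ω ∂μ : ℝ) * ∫ ω, tailExp X u n (k + 1) ω ∂μ‖
        ≤ a (j - k) * (A k * N j) * ((m + D) * ε) := by
      rw [← mul_sub, norm_mul]
      refine mul_le_mul hc ?_ (norm_nonneg _)
        (mul_nonneg (ha _) (mul_nonneg (hA k) (hN j)))
      rw [norm_sub_rev, ← integral_sub (H.integrable_tailExp _) (H.integrable_tailExp _)]
      refine (norm_integral_le_of_norm_le_const (C := (m + D) * ε)
        (ae_of_all _ fun ω => ?_)).trans_eq (by simp)
      refine (norm_tailExp_sub_le H.bound hε (by omega) (by omega)).trans ?_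
      gcongr
      have : q - (k + 1) ≤ m + D := by omega
      exact_mod_cast this
    calc _ ≤ _ := (norm_sub_le_norm_sub_add_norm_sub _ _ _).trans
          (add_le_add t1 ((norm_sub_le_norm_sub_add_norm_sub _ _ _).trans (add_le_add t2 t3)))
      _ = _ := by ring
  -- Distant pairs need no decoupling: each of the two terms is already of size a_{j-k}, whose sum
  -- over lags at least D is small.
  · rw [if_neg hd, if_neg hd, zero_mul, add_zero]
    refine (norm_sub_le _ _).trans ?_
    rw [norm_mul]
    have t1 := H.decay₂ hkj (H.meas_tailExp (u := u) (n := n) (Nat.le_succ j)) (C := 1)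
      fun ω => norm_tailExp.le
    have t2 := mul_le_mul hc (hE (k + 1)) (norm_nonneg _)
      (mul_nonneg (ha _) (mul_nonneg (hA k) (hN j)))
    linarith

/-- The characteristic function increments, with the product moments decoupled. -/
lemma norm_step_le (H : Decorrelated μ X ℱ N A a) {ε : ℝ} (hε0 : 0 ≤ ε) (hε1 : ε ≤ 1)
    (hε : ∀ k < n, |u| * N k ≤ ε) (D m : ℕ) {k : ℕ} (hk : k < n) :
    ‖(∫ ω, tailExp X u n k ω ∂μ) - (∫ ω, tailExp X u n (k + 1) ω ∂μ)
        + (u ^ 2 * ∑ j ∈ Finset.Ico k n, diagHalf k j * ∫ ω, X k ω * X j ω ∂μ : ℝ)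
          * ∫ ω, tailExp X u n (k + 1) ω ∂μ‖
      ≤ u ^ 2 * (ε * N k ^ 2 + ε * ∑ j ∈ Finset.Ico k n, a (j - k) * (A k * N j)
        + (∑ j ∈ Finset.Ico k n, (if j - k < D then a (j - k) * ((2 * m + D) * ε)
            else 2 * a (j - k)) * (A k * N j)
          + ∑ j ∈ Finset.Ico k n, (if j - k < D then a m else 0) * (N k * A j))) := by
  have : Nonempty S := nonempty_of_isProbabilityMeasure μ
  have hA := H.A_nonneg
  have ha := H.a_nonneg
  have hN := H.N_nonneg
  have h1 := H.norm_increment_le hε1 hε hk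
  set E0 := ∫ ω, tailExp X u n k ω ∂μ
  set E1 := ∫ ω, tailExp X u n (k + 1) ω ∂μ
  set Q := fun j => ∫ ω, (X k ω : ℂ) * X j ω * tailExp X u n (j + 1) ω ∂μ with hQ
  have h2 : ‖∑ j ∈ Finset.Ico k n, (diagHalf k j : ℂ)
      * (Q j - (∫ ω, X k ω * X j ω ∂μ : ℝ) * E1)‖
      ≤ ∑ j ∈ Finset.Ico k n, ((if j - k < D then a (j - k) * ((2 * m + D) * ε)
            else 2 * a (j - k)) * (A k * N j) + (if j - k < D then a m else 0) * (N k * A j)) := by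
    refine norm_sum_le_of_le _ fun j hj => ?_
    obtain ⟨hkj, hjn⟩ := Finset.mem_Ico.1 hj
    rw [norm_mul, Complex.norm_real, Real.norm_eq_abs, abs_of_nonneg (diagHalf_nonneg k j)]
    exact (mul_le_of_le_one_left (norm_nonneg _) (diagHalf_le_one k j)).trans
      (H.norm_decouple_le hε0 hε D m hkj hjn)
  rw [Finset.sum_add_distrib] at h2
  have e : E0 - E1 + (u ^ 2 * ∑ j ∈ Finset.Ico k n, diagHalf k j * ∫ ω, X k ω * X j ω ∂μ : ℝ) * E1
      = (E0 - E1 + u ^ 2 * ∑ j ∈ Finset.Ico k n, (diagHalf k j : ℂ) * Q j)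
        - u ^ 2 * ∑ j ∈ Finset.Ico k n, (diagHalf k j : ℂ)
          * (Q j - (∫ ω, X k ω * X j ω ∂μ : ℝ) * E1) := by
    simp only [mul_sub, Finset.sum_sub_distrib]
    push_cast
    rw [mul_assoc ((u : ℂ) ^ 2) _ E1, Finset.sum_mul]
    simp only [mul_assoc]
    ring
  rw [e]
  refine (norm_sub_le _ _).trans ?_
  rw [norm_mul, norm_pow, Complex.norm_real, Real.norm_eq_abs, sq_abs]
  have h3 : ∑ j ∈ Finset.Ico (k + 1) n, u ^ 2 * ε * (a (j - k) * (A k * N j))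
      ≤ u ^ 2 * ε * ∑ j ∈ Finset.Ico k n, a (j - k) * (A k * N j) := by
    rw [← Finset.mul_sum]
    refine mul_le_mul_of_nonneg_left ?_ (by positivity)
    exact Finset.sum_le_sum_of_subset_of_nonneg (Finset.Ico_subset_Ico_left (Nat.le_succ k))
      fun j _ _ => mul_nonneg (ha _) (mul_nonneg (hA k) (hN j))
  have h4 := mul_le_mul_of_nonneg_left h2 (sq_nonneg u)
  linarith

/-- Non-asymptotic comparison of the characteristic function of `∑_{k < n} X k` with that of the
normal law with the same variance. -/
lemma norm_charFun_sub_le (H : Decorrelated μ X ℱ N A a) {ε B s τ : ℝ} (hε0 : 0 ≤ ε) (hε1 : ε ≤ 1)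
    (hεN : ∀ k < n, |u| * N k ≤ ε) (hεA : ∀ k < n, |u| * A k ≤ ε) (D m : ℕ)
    (hN2 : ∑ k ∈ Finset.range n, N k ^ 2 ≤ B) (hA2 : ∑ k ∈ Finset.range n, A k ^ 2 ≤ B)
    (hs : ∀ M, ∑ d ∈ Finset.range M, a d ≤ s) (hτ : ∀ M, ∑ d ∈ Finset.Ico D M, a d ≤ τ)
    (hεs : ε * s ≤ 1) :
    ‖(∫ ω, tailExp X u n 0 ω ∂μ)
        - Real.exp (-(u ^ 2 * ((∫ ω, (∑ k ∈ Finset.range n, X k ω) ^ 2 ∂μ) / 2)))‖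
      ≤ Real.exp (s * (u ^ 2 * B)) * ((u ^ 2 * B)
        * (ε * (1 + s + (2 * m + D) * s + s * s) + 2 * τ + D * a m)) := by
  have : Nonempty S := nonempty_of_isProbabilityMeasure μ
  have hA := H.A_nonneg
  have ha := H.a_nonneg
  have hN := H.N_nonneg
  have hs0 : 0 ≤ s := by simpa using hs 0
  have hτ0 : 0 ≤ τ := by simpa using hτ 0
  have hB0 : 0 ≤ B := (Finset.sum_nonneg fun k _ => sq_nonneg (N k)).trans hN2
  set G := u ^ 2 * B with hG
  have hG0 : 0 ≤ G := by positivity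
  set w := fun k => ∑ j ∈ Finset.Ico k n, a (j - k) * (A k * N j) with hw
  have hw0 : ∀ k, 0 ≤ w k := fun k =>
    Finset.sum_nonneg fun j _ => mul_nonneg (ha _) (mul_nonneg (hA k) (hN j))
  set β := fun k => u ^ 2 * w k with hβ
  have hβ0 : ∀ k, 0 ≤ β k := fun k => mul_nonneg (sq_nonneg u) (hw0 k)
  set x := fun k => u ^ 2 * ∑ j ∈ Finset.Ico k n, diagHalf k j * ∫ ω, X k ω * X j ω ∂μ with hx
  set h := fun k => ∫ ω, tailExp X u n k ω ∂μ with hh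
  have hwsum : ∑ k ∈ Finset.range n, w k ≤ s * B :=
    (sum_sum_weight_mul_le ha hA2 hN2).trans (mul_le_mul_of_nonneg_right (hs n) hB0)
  have hβsum : ∑ k ∈ Finset.range n, β k ≤ s * G := by
    rw [hβ, ← Finset.mul_sum, hG]
    nlinarith [mul_le_mul_of_nonneg_left hwsum (sq_nonneg u)]
  have hxβ : ∀ k < n, |x k| ≤ β k := by
    intro k _
    rw [hx, abs_mul, abs_of_nonneg (sq_nonneg u)]
    refine mul_le_mul_of_nonneg_left ?_ (sq_nonneg u)
    refine (Finset.abs_sum_le_sum_abs _ _).trans (Finset.sum_le_sum fun j hj => ?_)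
    rw [abs_mul, abs_of_nonneg (diagHalf_nonneg k j)]
    exact (mul_le_of_le_one_left (abs_nonneg _) (diagHalf_le_one k j)).trans
      (H.abs_integral_mul_le (Finset.mem_Ico.1 hj).1)
  -- Distributing u² as |u| A_k · |u| N_j makes every coefficient at most εs, so the sum of squares
  -- in Gronwall is at most εs times the sum of the β_k.
  have hβε : ∀ k < n, β k ≤ ε * s := by
    intro k hk
    have h1 : β k = ∑ j ∈ Finset.Ico k n, a (j - k) * ((|u| * A k) * (|u| * N j)) := by
      simp only [hβ, hw]
      rw [Finset.mul_sum]
      refine Finset.sum_congr rfl fun j _ => ?_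
      rw [← sq_abs u]
      ring
    rw [h1]
    calc _ ≤ ∑ j ∈ Finset.Ico k n, a (j - k) * (ε * 1) := by
          refine Finset.sum_le_sum fun j hj => ?_
          refine mul_le_mul_of_nonneg_left ?_ (ha _)
          exact mul_le_mul (hεA k hk) ((hεN j (Finset.mem_Ico.1 hj).2).trans hε1)
            (mul_nonneg (abs_nonneg u) (hN j)) hε0
      _ = ε * ∑ d ∈ Finset.range (n - k), a d := by
          rw [Finset.sum_Ico_eq_sum_range, Finset.mul_sum]
          exact Finset.sum_congr rfl fun d _ => by rw [Nat.add_sub_cancel_left]; ring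
      _ ≤ ε * s := mul_le_mul_of_nonneg_left (hs _) hε0
  have hGr := norm_sub_exp_neg_sum_le (n := n) (h := h) (x := x) (β := β)
    (by simp [hh, tailExp_self])
    (fun k => (norm_integral_le_of_norm_le_const (C := 1)
      (ae_of_all _ fun ω => norm_tailExp.le)).trans_eq (by simp))
    hxβ (fun k hk => (hβε k hk).trans hεs)
  have hxsum : ∑ k ∈ Finset.range n, x k
      = u ^ 2 * ((∫ ω, (∑ k ∈ Finset.range n, X k ω) ^ 2 ∂μ) / 2) := by
    have hi : ∀ k j, Integrable (fun ω => diagHalf k j * (X k ω * X j ω)) μ := by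
      intro k j
      refine Integrable.const_mul ?_ _
      refine Integrable.of_bound ((H.measurable k).mul (H.measurable j)).aestronglyMeasurable
        (N k * N j) (ae_of_all _ fun ω => ?_)
      rw [norm_mul]
      exact mul_le_mul (H.bound k ω) (H.bound j ω) (norm_nonneg _) (hN k)
    rw [hx, ← Finset.mul_sum, ← integral_div]
    congr 1
    simp_rw [← sum_diagHalf_mul, ← integral_const_mul]
    rw [integral_finsetSum _ fun k _ => integrable_finsetSum _ fun j _ => hi k j]
    exact Finset.sum_congr rfl fun k _ => (integral_finsetSum _ fun j _ => hi k j).symm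
  rw [hxsum] at hGr
  refine hGr.trans ?_
  refine mul_le_mul (Real.exp_le_exp.2 hβsum) ?_
    (Finset.sum_nonneg fun k _ => by positivity) (Real.exp_pos _).le
  have hβ2 : ∑ k ∈ Finset.range n, β k ^ 2 ≤ ε * s * (s * G) := by
    calc _ ≤ ∑ k ∈ Finset.range n, ε * s * β k := by
          refine Finset.sum_le_sum fun k hk => ?_
          have := hβε k (Finset.mem_range.1 hk)
          nlinarith [hβ0 k]
      _ ≤ _ := by
          rw [← Finset.mul_sum]
          exact mul_le_mul_of_nonneg_left hβsum (mul_nonneg hε0 hs0)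
  have hstep := Finset.sum_le_sum fun k (hk : k ∈ Finset.range n) =>
    H.norm_step_le hε0 hε1 hεN D m (Finset.mem_range.1 hk)
  rw [← Finset.mul_sum] at hstep
  simp only [Finset.sum_add_distrib, ← Finset.mul_sum] at hstep
  have w1 : ∑ k ∈ Finset.range n, ∑ j ∈ Finset.Ico k n,
      (if j - k < D then a (j - k) * ((2 * m + D) * ε) else 2 * a (j - k)) * (A k * N j)
      ≤ ((2 * m + D) * ε * s + 2 * τ) * B := by
    refine (sum_sum_weight_mul_le
      (w := fun d => if d < D then a d * ((2 * m + D) * ε) else 2 * a d) ?_ hA2 hN2).trans ?_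
    · intro d
      have := ha d
      split_ifs <;> positivity
    · refine mul_le_mul_of_nonneg_right ?_ hB0
      have hsplit : ∑ d ∈ Finset.range n, (if d < D then a d * ((2 * m + D) * ε) else 2 * a d)
          ≤ ∑ d ∈ Finset.range D, (2 * m + D) * ε * a d + ∑ d ∈ Finset.Ico D (n + D), 2 * a d := by
        calc _ ≤ ∑ d ∈ Finset.range (n + D),
              (if d < D then a d * ((2 * m + D) * ε) else 2 * a d) := by
              refine Finset.sum_le_sum_of_subset_of_nonneg
                (Finset.range_mono (Nat.le_add_right n D)) fun d _ _ => ?_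
              have := ha d
              split_ifs <;> positivity
          _ = _ := by
              rw [← Finset.sum_range_add_sum_Ico _ (Nat.le_add_left D n)]
              congr 1
              · refine Finset.sum_congr rfl fun d hd => ?_
                rw [if_pos (Finset.mem_range.1 hd), mul_comm]
              · refine Finset.sum_congr rfl fun d hd => ?_
                rw [if_neg (not_lt.2 (Finset.mem_Ico.1 hd).1)]
      refine hsplit.trans ?_
      rw [← Finset.mul_sum, ← Finset.mul_sum]
      have := hs D
      have := hτ (n + D)
      gcongr
  have w2 : ∑ k ∈ Finset.range n, ∑ j ∈ Finset.Ico k n,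
      (if j - k < D then a m else 0) * (N k * A j) ≤ D * a m * B := by
    refine (sum_sum_weight_mul_le (w := fun d => if d < D then a m else 0) ?_ hN2 hA2).trans ?_
    · intro d
      have := ha m
      split_ifs <;> positivity
    · refine mul_le_mul_of_nonneg_right ?_ hB0
      rw [← Finset.sum_filter, Finset.sum_const, nsmul_eq_mul]
      refine mul_le_mul_of_nonneg_right ?_ (ha m)
      have : (Finset.filter (fun d => d < D) (Finset.range n)).card ≤ (Finset.range D).card :=
        Finset.card_le_card fun d hd => Finset.mem_range.2 (Finset.mem_filter.1 hd).2
      rw [Finset.card_range] at this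
      exact_mod_cast this
  rw [Finset.sum_add_distrib]
  refine (add_le_add hstep hβ2).trans ?_
  have hb : ε * ∑ k ∈ Finset.range n, N k ^ 2 + ε * ∑ k ∈ Finset.range n, w k
      + (((2 * m + D) * ε * s + 2 * τ) * B + D * a m * B)
      ≤ B * (ε * (1 + s + (2 * m + D) * s) + 2 * τ + D * a m) := by
    have := mul_le_mul_of_nonneg_left hN2 hε0
    have := mul_le_mul_of_nonneg_left hwsum hε0
    linarith
  have := mul_le_mul_of_nonneg_left ((add_le_add_right (add_le_add w1 w2) _).trans hb)
    (sq_nonneg u)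
  rw [hG]
  linarith

/-- A Lindeberg type smallness: the maximum of x_k over k < n is o(√n). Late indices use x_k² ≤ δk ≤
δn; the finitely many early ones are absorbed by taking n large. -/
lemma eventually_forall_mul_le {x : ℕ → ℝ}
    (hx : Tendsto (fun n : ℕ => x n ^ 2 / n) atTop (𝓝 0)) (t : ℝ) {ε : ℝ} (hε : 0 < ε) :
    ∀ᶠ n : ℕ in atTop, ∀ k < n, |t / √(n : ℝ)| * x k ≤ ε := by
  have hδ : 0 < (ε / (|t| + 1)) ^ 2 := by positivity
  obtain ⟨n₀, hn₀⟩ := eventually_atTop.1 ((hx.eventually_le_const hδ).and (eventually_ge_atTop 1))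
  have hC : ∀ᶠ n : ℕ in atTop, ∀ k < n₀, x k ^ 2 ≤ (ε / (|t| + 1)) ^ 2 * n := by
    filter_upwards [(tendsto_natCast_atTop_atTop.const_mul_atTop hδ).eventually_ge_atTop
      (∑ i ∈ Finset.range n₀, x i ^ 2)] with n hn k hk
    exact (Finset.single_le_sum (f := fun i => x i ^ 2) (fun i _ => sq_nonneg _)
      (Finset.mem_range.2 hk)).trans hn
  filter_upwards [hC, eventually_ge_atTop 1] with n hn hn1 k hk
  have hn0 : (0 : ℝ) < n := by exact_mod_cast hn1
  have hk2 : x k ^ 2 ≤ (ε / (|t| + 1)) ^ 2 * n := by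
    rcases lt_or_ge k n₀ with h | h
    · exact hn k h
    · obtain ⟨h1, h2⟩ := hn₀ k h
      have hk0 : (0 : ℝ) < k := by exact_mod_cast h2
      rw [div_le_iff₀ hk0] at h1
      have hkn : (k : ℝ) ≤ n := by exact_mod_cast hk.le
      exact h1.trans (mul_le_mul_of_nonneg_left hkn hδ.le)
  have hk3 : x k ≤ ε / (|t| + 1) * √n := by
    refine le_of_sq_le_sq ?_ (by positivity)
    rwa [mul_pow, Real.sq_sqrt hn0.le]
  have hs : 0 < √(n : ℝ) := Real.sqrt_pos.2 hn0
  rw [abs_div, abs_of_pos hs]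
  calc |t| / √n * x k ≤ |t| / √n * (ε / (|t| + 1) * √n) := by gcongr
    _ = ε * (|t| / (|t| + 1)) := by field_simp
    _ ≤ ε * 1 := by
        gcongr
        exact (div_le_one (by positivity)).2 (by linarith)
    _ = ε := mul_one ε

/-- **Central limit theorem** for decorrelated sequences, in terms of characteristic functions. -/
theorem tendsto_charFun (H : Decorrelated μ X ℱ N A a) (ha : Summable a) {Q V : ℝ}
    (hN2 : ∀ n : ℕ, ∑ k ∈ Finset.range n, N k ^ 2 ≤ Q * n)
    (hA2 : ∀ n : ℕ, ∑ k ∈ Finset.range n, A k ^ 2 ≤ Q * n)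
    (hN0 : Tendsto (fun n : ℕ => N n ^ 2 / n) atTop (𝓝 0))
    (hA0 : Tendsto (fun n : ℕ => A n ^ 2 / n) atTop (𝓝 0))
    (hV : Tendsto (fun n : ℕ => 1 / (n : ℝ) * ∫ ω, (∑ k ∈ Finset.range n, X k ω) ^ 2 ∂μ) atTop
      (𝓝 V)) (t : ℝ) :
    Tendsto (fun n : ℕ => ∫ ω, tailExp X (t / √(n : ℝ)) n 0 ω ∂μ) atTop
      (𝓝 (Real.exp (-(t ^ 2 * (V / 2))) : ℂ)) := by
  have : Nonempty S := nonempty_of_isProbabilityMeasure μ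
  have hQ0 : 0 ≤ Q := by
    have := hN2 1
    simp only [Finset.sum_range_one, Nat.cast_one, mul_one] at this
    exact (sq_nonneg _).trans this
  set s := ∑' d, a d with hs
  have hs0 : 0 ≤ s := tsum_nonneg H.a_nonneg
  have hu : ∀ n : ℕ, 1 ≤ n → ∀ c : ℝ, (t / √(n : ℝ)) ^ 2 * c = t ^ 2 * (1 / (n : ℝ) * c) := by
    intro n hn c
    rw [div_pow, Real.sq_sqrt (Nat.cast_nonneg n)]
    ring
  have hlim : Tendsto (fun n : ℕ => ((Real.exp (-((t / √(n : ℝ)) ^ 2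
      * ((∫ ω, (∑ k ∈ Finset.range n, X k ω) ^ 2 ∂μ) / 2))) : ℝ) : ℂ)) atTop
      (𝓝 (Real.exp (-(t ^ 2 * (V / 2))) : ℂ)) := by
    refine (Complex.continuous_ofReal.tendsto _).comp ((Real.continuous_exp.tendsto _).comp ?_)
    refine Tendsto.congr' ?_ ((hV.div_const 2).const_mul (t ^ 2)).neg
    filter_upwards [eventually_ge_atTop 1] with n hn
    rw [hu n hn]
    ring
  suffices hdiff : Tendsto (fun n : ℕ => (∫ ω, tailExp X (t / √(n : ℝ)) n 0 ω ∂μ)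
      - ((Real.exp (-((t / √(n : ℝ)) ^ 2
      * ((∫ ω, (∑ k ∈ Finset.range n, X k ω) ^ 2 ∂μ) / 2))) : ℝ) : ℂ)) atTop (𝓝 0) by
    simpa using hdiff.add hlim
  set G := t ^ 2 * Q with hG
  have hG0 : 0 ≤ G := by positivity
  set C := Real.exp (s * G) * G + 1 with hC
  have hC0 : 0 < C := by positivity
  rw [Metric.tendsto_nhds]
  intro η hη
  -- The order of choice matters: the lag cutoff D makes the tail of the series small, the gap m
  -- then beats the D near lags, and ε last beats the constants depending on D and m. Each of the
  -- three errors gets at most η / (4C).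
  obtain ⟨D, hD⟩ := ((tendsto_sum_nat_add a).eventually_lt_const
    (show (0 : ℝ) < η / (8 * C) by positivity)).exists
  set τ := ∑' k, a (k + D) with hτ
  obtain ⟨m, hm⟩ := ((ha.tendsto_atTop_zero.const_mul (D : ℝ)).eventually_lt_const
    (show (D : ℝ) * 0 < η / (4 * C) by rw [mul_zero]; positivity)).exists
  set Z := 1 + s + (2 * m + D) * s + s * s with hZ
  have hZ0 : 0 < Z := by positivity
  set ε := min 1 (min (1 / (s + 1)) (η / (4 * C * Z))) with hε
  have hε0 : 0 < ε := by positivity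
  have hε1 : ε ≤ 1 := min_le_left _ _
  have hεs : ε * s ≤ 1 := by
    have h : ε ≤ 1 / (s + 1) := (min_le_right _ _).trans (min_le_left _ _)
    rw [le_div_iff₀ (by positivity)] at h
    linarith
  have hεZ : ε * Z ≤ η / (4 * C) := by
    have h : ε ≤ η / (4 * C * Z) := (min_le_right _ _).trans (min_le_right _ _)
    rw [le_div_iff₀ (by positivity)] at h ⊢
    linarith
  filter_upwards [eventually_forall_mul_le hN0 t hε0,
    eventually_forall_mul_le hA0 t hε0, eventually_ge_atTop 1] with n h1 h2 hn
  have hn0 : (n : ℝ) ≠ 0 := by positivity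
  have hmain := H.norm_charFun_sub_le (u := t / √(n : ℝ)) hε0.le hε1 h1 h2 D m (hN2 n) (hA2 n)
    (s := s) (τ := τ) (fun M => ha.sum_le_tsum _ fun d _ => H.a_nonneg d)
    (fun M => by
      rw [Finset.sum_Ico_eq_sum_range]
      simp_rw [add_comm D]
      exact ((summable_nat_add_iff D).2 ha).sum_le_tsum _ fun d _ => H.a_nonneg _) hεs
  have hGn : (t / √(n : ℝ)) ^ 2 * (Q * n) = G := by
    rw [hu n hn, hG]
    field_simp
  rw [hGn, ← hZ] at hmain
  rw [dist_zero_right]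
  have hsum : ε * Z + 2 * τ + D * a m < η / C := by
    have e1 : η / (8 * C) = η / C / 8 := by field_simp
    have e2 : η / (4 * C) = η / C / 4 := by field_simp
    rw [e1] at hD
    rw [e2] at hm hεZ
    have : 0 < η / C := by positivity
    linarith
  have hnn : 0 ≤ ε * Z + 2 * τ + D * a m := by
    have : 0 ≤ τ := tsum_nonneg fun d => H.a_nonneg _
    have := H.a_nonneg m
    positivity
  calc _ ≤ _ := hmain
    _ = (Real.exp (s * G) * G) * (ε * Z + 2 * τ + D * a m) := by ring
    _ ≤ C * (ε * Z + 2 * τ + D * a m) :=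
        mul_le_mul_of_nonneg_right (by rw [hC]; linarith) hnn
    _ < C * (η / C) := mul_lt_mul_of_pos_left hsum hC0
    _ = η := by field_simp

end Decorrelated

/-! ### Duality of transfer operators, and covariance bounds. -/

section Transfer

variable {M : Type*} [MeasurableSpace M] {T : M → M} {μ ν : Measure M}

lemma integrable_ofReal_mul {h : M → ℝ} (hh : Integrable h ν) {f : M → ℂ} (hf : Measurable f)
    {C : ℝ} (hC : ∀ᵐ x ∂ν, ‖f x‖ ≤ C) : Integrable (fun x => (h x : ℂ) * f x) ν :=
  hh.ofReal.mul_bdd hf.aestronglyMeasurable hC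

lemma integral_rnDeriv_map_withDensity [IsFiniteMeasure μ] [IsFiniteMeasure ν] (hT : Measurable T)
    (hmap : μ.map T = ν) {g : M → ℝ} (hg : Integrable g μ) :
    Integrable (fun x => (((μ.withDensity fun y => ENNReal.ofReal (g y)).map T).rnDeriv ν x).toReal)
      ν ∧ ∀ f : M → ℂ, Measurable f →
        ∫ x, ((((μ.withDensity fun y => ENNReal.ofReal (g y)).map T).rnDeriv ν x).toReal : ℂ) * f x
          ∂ν = ∫ y, (max (g y) 0 : ℝ) * f (T y) ∂μ := by
  have := isFiniteMeasure_withDensity_ofReal hg.2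
  set ρ := μ.withDensity fun y => ENNReal.ofReal (g y) with hρ
  have hac : ρ.map T ≪ ν := hmap ▸ (withDensity_absolutelyContinuous _ _).map hT
  refine ⟨Measure.integrable_toReal_rnDeriv, fun f hf => ?_⟩
  have h1 := integral_rnDeriv_smul hac (f := f)
  simp only [Complex.real_smul] at h1
  rw [h1, integral_map hT.aemeasurable hf.aestronglyMeasurable, hρ,
    integral_withDensity_eq_integral_toReal_smul₀ hg.aemeasurable.ennreal_ofReal
      (ae_of_all _ fun _ => ENNReal.ofReal_lt_top)]
  simp only [ENNReal.toReal_ofReal', Complex.real_smul]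

/-- The transfer operator is dual to composition with `T`. -/
lemma integral_transferOperator_mul [IsFiniteMeasure μ] [IsFiniteMeasure ν] (hT : Measurable T)
    (hmap : μ.map T = ν) {g : M → ℝ} (hg : Integrable g μ) :
    Integrable (transferOperator T μ ν g) ν ∧ ∀ f : M → ℂ, Measurable f →
      ∀ C : ℝ, (∀ᵐ x ∂ν, ‖f x‖ ≤ C) →
        ∫ x, (transferOperator T μ ν g x : ℂ) * f x ∂ν = ∫ y, (g y : ℂ) * f (T y) ∂μ := by
  obtain ⟨i1, e1⟩ := integral_rnDeriv_map_withDensity hT hmap hg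
  obtain ⟨i2, e2⟩ := integral_rnDeriv_map_withDensity hT hmap hg.neg
  refine ⟨i1.sub i2, fun f hf C hC => ?_⟩
  have hC' : ∀ᵐ y ∂μ, ‖f (T y)‖ ≤ C := by
    rw [← hmap] at hC
    exact ae_of_ae_map hT.aemeasurable hC
  have e1 := e1 f hf
  have e2 := e2 f hf
  simp only [transferOperator, Complex.ofReal_sub, sub_mul]
  simp only [Pi.neg_apply] at e2 i2
  have hfT : Measurable fun y => f (T y) := hf.comp hT
  rw [integral_sub (integrable_ofReal_mul i1 hf hC) (integrable_ofReal_mul i2 hf hC), e1, e2,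
    ← integral_sub (integrable_ofReal_mul (h := fun y => max (g y) 0) hg.pos_part hfT hC')
      (integrable_ofReal_mul (h := fun y => max (-g y) 0) hg.neg.pos_part hfT hC')]
  refine integral_congr_ae (ae_of_all _ fun y => ?_)
  dsimp only
  rw [← sub_mul, ← Complex.ofReal_sub]
  congr 2
  rcases le_total 0 (g y) with h | h
  · rw [max_eq_left h, max_eq_right (by linarith)]; ring
  · rw [max_eq_right h, max_eq_left (by linarith)]; ring

end Transfer

section Covariance

variable {M : Type*} [MeasurableSpace M] {ν : Measure M} [IsProbabilityMeasure ν]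

/-- The difference is the integral of the centred `h` against `f`. On a probability space with s ≥
1, the L^s bound controls the L¹ norm, which pairs with the sup norm of `f`. -/
lemma norm_integral_mul_sub_le {h : M → ℝ} (hh : Integrable h ν) {f : M → ℂ} (hf : Measurable f)
    {C b s : ℝ} (hs : 1 ≤ s) (hb : 0 ≤ b) (hfC : ∀ᵐ x ∂ν, ‖f x‖ ≤ C)
    (hL : eLpNorm (fun x => h x - ∫ y, h y ∂ν) (ENNReal.ofReal s) ν ≤ ENNReal.ofReal b) :
    ‖∫ x, (h x : ℂ) * f x ∂ν - (∫ x, h x ∂ν : ℝ) * ∫ x, f x ∂ν‖ ≤ b * C := by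
  have hc : Integrable (fun x => h x - ∫ y, h y ∂ν) ν := hh.sub (integrable_const _)
  have i1 : Integrable (fun x => (h x : ℂ) * f x) ν :=
    integrable_ofReal_mul hh hf hfC
  have i2 : Integrable f ν := Integrable.of_bound hf.aestronglyMeasurable C hfC
  have hC0 : 0 ≤ C := by
    obtain ⟨x, hx⟩ := hfC.exists
    exact (norm_nonneg _).trans hx
  have h1 : eLpNorm (fun x => h x - ∫ y, h y ∂ν) 1 ν ≤ ENNReal.ofReal b :=
    (eLpNorm_le_eLpNorm_of_exponent_le (by simpa using hs) hc.aestronglyMeasurable).trans hL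
  have h2 : ∫ x, ‖h x - ∫ y, h y ∂ν‖ ∂ν ≤ b := by
    rw [integral_norm_eq_lintegral_enorm hc.aestronglyMeasurable, ← eLpNorm_one_eq_lintegral_enorm]
    exact ENNReal.toReal_le_of_le_ofReal hb h1
  rw [← integral_const_mul, ← integral_sub i1 (i2.const_mul _)]
  calc _ ≤ ∫ x, ‖h x - ∫ y, h y ∂ν‖ * C ∂ν := by
        refine norm_integral_le_of_norm_le (hc.norm.mul_const C) ?_
        filter_upwards [hfC] with x hx
        rw [← sub_mul, ← Complex.ofReal_sub, norm_mul, Complex.norm_real]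
        exact mul_le_mul_of_nonneg_left hx (norm_nonneg _)
    _ ≤ b * C := by
        rw [integral_mul_const]
        exact mul_le_mul_of_nonneg_right h2 hC0

end Covariance

section LipNorm

variable {M : Type*} [MetricSpace M]

lemma abs_le_lipNorm {F : Set M} {g : M → ℝ} (hg : lipNorm F g ≠ ∞) {x : M} (hx : x ∈ F) :
    |g x| ≤ (lipNorm F g).toReal := by
  have h : ‖g x‖ₑ ≤ lipNorm F g :=
    (le_iSup₂ (f := fun y (_ : y ∈ F) => ‖g y‖ₑ) x hx).trans le_self_add
  have h2 := ENNReal.toReal_mono hg h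
  rwa [toReal_enorm, Real.norm_eq_abs] at h2

lemma lipNorm_one_le (F : Set M) : lipNorm F (fun _ => (1 : ℝ)) ≤ 1 := by
  have h : (⨆ x ∈ F, ⨆ y ∈ F, edist (1 : ℝ) 1 / edist x y) = 0 := by simp
  rw [lipNorm, h, add_zero]
  exact iSup₂_le fun _ _ => by simp

end LipNorm

/-! ### Cocycles along an orbit; from memory loss to decorrelation. -/

namespace RandomSystem

variable {Ω M : Type*} [MeasurableSpace Ω] [MetricSpace M] [MeasurableSpace M] [BorelSpace M]
  {P : Measure Ω} (D : RandomSystem Ω M P)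

lemma iterT_add (ω : Ω) (k n : ℕ) :
    D.iterT ω (k + n) = D.iterT (D.σ^[k] ω) n ∘ D.iterT ω k := by
  induction n with
  | zero => rfl
  | succ n ih =>
    rw [← add_assoc]
    simp only [iterT]
    rw [ih, ← Function.iterate_add_apply, add_comm n k]
    rfl

lemma ae_mem_fiber (ω : Ω) : ∀ᵐ x ∂(D.μ ω), x ∈ D.fiber ω := by
  rw [ae_iff]
  exact D.measure_compl_fiber ω

lemma measurable_iterT (hT : ∀ ω, Measurable (D.T ω)) (ω : Ω) (n : ℕ) :
    Measurable (D.iterT ω n) := by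
  induction n with
  | zero => exact measurable_id
  | succ n ih => exact (hT _).comp ih

/-- The equivariance of the measures along the whole orbit of `ω`. -/
def EquivariantAt (ω : Ω) : Prop :=
  ∀ k, (D.μ (D.σ^[k] ω)).map (D.T (D.σ^[k] ω)) = D.μ (D.σ^[k + 1] ω)

variable {D}

lemma EquivariantAt.iterate {ω : Ω} (h : D.EquivariantAt ω) (n : ℕ) :
    D.EquivariantAt (D.σ^[n] ω) := fun k => by
  rw [← Function.iterate_add_apply, ← Function.iterate_add_apply, h (k + n)]
  congr 2
  omega

lemma EquivariantAt.map_iterT (hT : ∀ ω, Measurable (D.T ω)) {ω : Ω} (h : D.EquivariantAt ω)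
    (n : ℕ) : (D.μ ω).map (D.iterT ω n) = D.μ (D.σ^[n] ω) := by
  induction n with
  | zero => exact Measure.map_id
  | succ n ih =>
    rw [iterT, ← Measure.map_map (hT _) (D.measurable_iterT hT ω n), ih, h n]

lemma EquivariantAt.integral_iterL_mul (hT : ∀ ω, Measurable (D.T ω)) {ω : Ω}
    (h : D.EquivariantAt ω) {g : M → ℝ} (hg : Integrable g (D.μ ω)) (n : ℕ) :
    Integrable (D.iterL ω n g) (D.μ (D.σ^[n] ω)) ∧ ∀ f : M → ℂ, Measurable f →
      ∀ C : ℝ, (∀ᵐ x ∂(D.μ (D.σ^[n] ω)), ‖f x‖ ≤ C) →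
        ∫ x, (D.iterL ω n g x : ℂ) * f x ∂(D.μ (D.σ^[n] ω))
          = ∫ y, (g y : ℂ) * f (D.iterT ω n y) ∂(D.μ ω) := by
  induction n with
  | zero => exact ⟨hg, fun f _ C _ => rfl⟩
  | succ n ih =>
    obtain ⟨i, e⟩ := ih
    have hm := h n
    have hs : D.σ (D.σ^[n] ω) = D.σ^[n + 1] ω := (Function.iterate_succ_apply' _ _ _).symm
    obtain ⟨i', e'⟩ := integral_transferOperator_mul (hT (D.σ^[n] ω)) hm i
    simp only [iterL, L, Function.comp_apply, hs]
    refine ⟨i', fun f hf C hC => ?_⟩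
    rw [e' f hf C hC]
    refine e _ (hf.comp (hT _)) C ?_
    rw [← hm] at hC
    exact ae_of_ae_map (hT _).aemeasurable hC

end RandomSystem

namespace RandomSystem

variable {Ω M : Type*} [MeasurableSpace Ω] [MetricSpace M] [MeasurableSpace M] [BorelSpace M]
  {P : Measure Ω}

/-- The memory loss estimate along the orbit of `ω`. -/
def MemoryLossAt (D : RandomSystem Ω M P) (s : ℝ) (K : Ω → ℝ) (a : ℕ → ℝ) (ω : Ω) : Prop :=
  ∀ l i j : ℕ, l ≤ i → i ≤ j → ∀ g₁ g₂ : M → ℝ,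
    lipNorm (D.fiber (D.σ^[l] ω)) g₁ ≠ ∞ → lipNorm (D.fiber (D.σ^[i] ω)) g₂ ≠ ∞ →
    eLpNorm
        (D.center (D.σ^[j] ω)
          (D.iterL (D.σ^[i] ω) (j - i) (fun x => g₂ x * D.iterL (D.σ^[l] ω) (i - l) g₁ x)))
        (ENNReal.ofReal s) (D.μ (D.σ^[j] ω))
      ≤ ENNReal.ofReal (K (D.σ^[i] ω) * a (j - i)
          * (1 + (lipNorm (D.fiber (D.σ^[l] ω)) g₁).toReal)
          * (1 + (lipNorm (D.fiber (D.σ^[i] ω)) g₂).toReal))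

variable {D : RandomSystem Ω M P} {s : ℝ} {K : Ω → ℝ} {a : ℕ → ℝ} {ω : Ω}

lemma iterate_sub_iterate {i j : ℕ} (hij : i ≤ j) :
    D.σ^[j - i] (D.σ^[i] ω) = D.σ^[j] ω := by
  rw [← Function.iterate_add_apply, Nat.sub_add_cancel hij]

lemma iterT_sub_iterT {i j : ℕ} (hij : i ≤ j) (x : M) :
    D.iterT (D.σ^[i] ω) (j - i) (D.iterT ω i x) = D.iterT ω j x := by
  have := congrFun (D.iterT_add ω i (j - i)) x
  rw [Nat.add_sub_cancel' hij] at this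
  exact this.symm

lemma EquivariantAt.integral_comp_iterT (hT : ∀ ω, Measurable (D.T ω)) (h : D.EquivariantAt ω)
    {E : Type*} [NormedAddCommGroup E] [NormedSpace ℝ E] (n : ℕ) {f : M → E}
    (hf : AEStronglyMeasurable f (D.μ (D.σ^[n] ω))) :
    ∫ x, f (D.iterT ω n x) ∂(D.μ ω) = ∫ y, f y ∂(D.μ (D.σ^[n] ω)) := by
  rw [← h.map_iterT hT n] at hf ⊢
  exact (integral_map (D.measurable_iterT hT ω n).aemeasurable hf).symm

/-- Applying duality from l to i and then from i to j writes the triple integral as that of `f`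
against L^{j-i}(g₂ L^{i-l} g₁). Centring this density subtracts exactly the product of the two
means. -/
lemma MemoryLossAt.norm_sub_le (hM : D.MemoryLossAt s K a ω) (hT : ∀ ω, Measurable (D.T ω))
    (hE : D.EquivariantAt ω) (hs : 1 ≤ s) (ha : ∀ n, 0 ≤ a n) {l i j : ℕ} (hli : l ≤ i)
    (hij : i ≤ j) {g₁ g₂ : M → ℝ} (hg₁ : Measurable g₁) (hg₂ : Measurable g₂)
    (h₁ : lipNorm (D.fiber (D.σ^[l] ω)) g₁ ≠ ∞) (h₂ : lipNorm (D.fiber (D.σ^[i] ω)) g₂ ≠ ∞)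
    {f : M → ℂ} (hf : Measurable f) {C : ℝ} (hC : ∀ᵐ x ∂(D.μ (D.σ^[j] ω)), ‖f x‖ ≤ C) :
    ‖∫ x, (g₁ (D.iterT ω l x) : ℂ) * g₂ (D.iterT ω i x) * f (D.iterT ω j x) ∂(D.μ ω)
        - (∫ x, g₁ (D.iterT ω l x) * g₂ (D.iterT ω i x) ∂(D.μ ω) : ℝ)
          * ∫ x, f (D.iterT ω j x) ∂(D.μ ω)‖
      ≤ |K (D.σ^[i] ω)| * a (j - i)
          * (1 + (lipNorm (D.fiber (D.σ^[l] ω)) g₁).toReal)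
          * (1 + (lipNorm (D.fiber (D.σ^[i] ω)) g₂).toReal) * C := by
  have b₁ : ∀ᵐ x ∂(D.μ (D.σ^[l] ω)), ‖g₁ x‖ ≤ (lipNorm (D.fiber (D.σ^[l] ω)) g₁).toReal := by
    filter_upwards [D.ae_mem_fiber (D.σ^[l] ω)] with x hx using abs_le_lipNorm h₁ hx
  have b₂ : ∀ᵐ x ∂(D.μ (D.σ^[i] ω)), ‖g₂ x‖ ≤ (lipNorm (D.fiber (D.σ^[i] ω)) g₂).toReal := by
    filter_upwards [D.ae_mem_fiber (D.σ^[i] ω)] with x hx using abs_le_lipNorm h₂ hx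
  have i₁ : Integrable g₁ (D.μ (D.σ^[l] ω)) := Integrable.of_bound hg₁.aestronglyMeasurable _ b₁
  obtain ⟨j₁, e₁⟩ := (hE.iterate l).integral_iterL_mul hT i₁ (i - l)
  rw [iterate_sub_iterate hli] at j₁ e₁
  set w := fun x => g₂ x * D.iterL (D.σ^[l] ω) (i - l) g₁ x with hw
  have i₂ : Integrable w (D.μ (D.σ^[i] ω)) :=
    j₁.bdd_mul hg₂.aestronglyMeasurable b₂
  obtain ⟨j₂, e₂⟩ := (hE.iterate i).integral_iterL_mul hT i₂ (j - i)
  rw [iterate_sub_iterate hij] at j₂ e₂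
  have mT := D.measurable_iterT hT
  have key : ∀ f : M → ℂ, Measurable f → ∀ C : ℝ, (∀ᵐ x ∂(D.μ (D.σ^[j] ω)), ‖f x‖ ≤ C) →
      ∫ x, (D.iterL (D.σ^[i] ω) (j - i) w x : ℂ) * f x ∂(D.μ (D.σ^[j] ω))
      = ∫ x, (g₁ (D.iterT ω l x) : ℂ) * g₂ (D.iterT ω i x) * f (D.iterT ω j x) ∂(D.μ ω) := by
    intro f hf C hC
    have hC' : ∀ᵐ x ∂(D.μ (D.σ^[i] ω)), ‖f (D.iterT (D.σ^[i] ω) (j - i) x)‖ ≤ C := by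
      rw [← iterate_sub_iterate hij, ← (hE.iterate i).map_iterT hT] at hC
      exact ae_of_ae_map (mT _ _).aemeasurable hC
    rw [e₂ f hf C hC]
    have hfm : Measurable fun x => (g₂ x : ℂ) * f (D.iterT (D.σ^[i] ω) (j - i) x) :=
      (Complex.measurable_ofReal.comp hg₂).mul (hf.comp (mT _ _))
    have e₃ := e₁ _ hfm ((lipNorm (D.fiber (D.σ^[i] ω)) g₂).toReal * C) (by
      filter_upwards [b₂, hC'] with x hx hx'
      rw [norm_mul, Complex.norm_real]
      exact mul_le_mul hx hx' (norm_nonneg _) ((norm_nonneg _).trans hx))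
    have e₄ : ∫ x, (w x : ℂ) * f (D.iterT (D.σ^[i] ω) (j - i) x) ∂(D.μ (D.σ^[i] ω))
        = ∫ x, (D.iterL (D.σ^[l] ω) (i - l) g₁ x : ℂ)
          * ((g₂ x : ℂ) * f (D.iterT (D.σ^[i] ω) (j - i) x)) ∂(D.μ (D.σ^[i] ω)) := by
      refine integral_congr_ae (ae_of_all _ fun x => ?_)
      simp only [hw]
      push_cast
      ring
    have hFm : Measurable fun y => (g₁ y : ℂ) * ((g₂ (D.iterT (D.σ^[l] ω) (i - l) y) : ℂ)
        * f (D.iterT (D.σ^[i] ω) (j - i) (D.iterT (D.σ^[l] ω) (i - l) y))) :=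
      (Complex.measurable_ofReal.comp hg₁).mul (hfm.comp (mT _ _))
    rw [e₄, e₃, ← hE.integral_comp_iterT hT l hFm.aestronglyMeasurable]
    refine integral_congr_ae (ae_of_all _ fun x => ?_)
    simp only [iterT_sub_iterT hli, iterT_sub_iterT hij]
    ring
  -- Testing against 1 identifies the mean of the density with E[g₁ ∘ T^l · g₂ ∘ T^i].
  have k1 := key (fun _ => 1) measurable_const 1 (by simp)
  simp only [mul_one] at k1
  have k2 : ∫ x, D.iterL (D.σ^[i] ω) (j - i) w x ∂(D.μ (D.σ^[j] ω))
      = ∫ x, g₁ (D.iterT ω l x) * g₂ (D.iterT ω i x) ∂(D.μ ω) := by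
    rw [integral_complex_ofReal] at k1
    simp_rw [← Complex.ofReal_mul] at k1
    rw [integral_complex_ofReal] at k1
    exact_mod_cast k1
  rw [← key f hf C hC, ← k2, hE.integral_comp_iterT hT j hf.aestronglyMeasurable]
  refine norm_integral_mul_sub_le j₂ hf hs ?_ hC ?_
  · have := ha (j - i); positivity
  · refine (hM l i j hli hij g₁ g₂ h₁ h₂).trans (ENNReal.ofReal_le_ofReal ?_)
    have := ha (j - i)
    gcongr
    exact le_abs_self _

/-- Along a good orbit, the observables form a decorrelated sequence. -/
theorem MemoryLossAt.decorrelated (hM : D.MemoryLossAt s K a ω) (hT : ∀ ω, Measurable (D.T ω))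
    (hE : D.EquivariantAt ω) (hs : 1 ≤ s) (ha : ∀ n, 0 ≤ a n) (ha' : Antitone a)
    {φ : Ω → M → ℝ} (hφ : ∀ ω, Measurable (φ ω)) (hφ0 : ∀ ω, ∀ x ∉ D.fiber ω, φ ω x = 0)
    (hmean : ∀ k, ∫ x, φ (D.σ^[k] ω) x ∂(D.μ (D.σ^[k] ω)) = 0)
    (hlip : ∀ k, lipNorm (D.fiber (D.σ^[k] ω)) (φ (D.σ^[k] ω)) ≠ ∞) :
    Decorrelated (D.μ ω) (fun k x => φ (D.σ^[k] ω) (D.iterT ω k x))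
      (fun k => MeasurableSpace.comap (D.iterT ω k) inferInstance)
      (fun k => 1 + (lipNorm (D.fiber (D.σ^[k] ω)) (φ (D.σ^[k] ω))).toReal)
      (fun k => 2 * (|K (D.σ^[k] ω)|
        * (1 + (lipNorm (D.fiber (D.σ^[k] ω)) (φ (D.σ^[k] ω))).toReal))) a := by
  have mT := D.measurable_iterT hT
  have hmean' : ∀ k, ∫ x, φ (D.σ^[k] ω) (D.iterT ω k x) ∂(D.μ ω) = 0 := fun k => by
    rw [hE.integral_comp_iterT hT k (hφ _).aestronglyMeasurable, hmean k]
  have hg : ∀ j, ∀ g : M → ℂ, Measurable[MeasurableSpace.comap (D.iterT ω j) inferInstance] g →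
      ∀ C : ℝ, (∀ x, ‖g x‖ ≤ C) → ∃ f : M → ℂ, Measurable f ∧ g = f ∘ D.iterT ω j ∧
        ∀ᵐ x ∂(D.μ (D.σ^[j] ω)), ‖f x‖ ≤ C := by
    intro j g hg C hC
    obtain ⟨f, hf, e⟩ := hg.exists_eq_measurable_comp
    refine ⟨f, hf, e, ?_⟩
    rw [← hE.map_iterT hT j, ae_map_iff (mT _ _).aemeasurable
      (measurableSet_le hf.norm measurable_const)]
    refine ae_of_all _ fun x => ?_
    have := hC x
    rwa [e] at this
  refine ⟨fun k => (mT ω k).comap_le, ?_, ?_, ?_, ?_, ha, ha', hmean', ?_, ?_⟩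
  · intro k j hkj
    have e : D.iterT ω j = D.iterT (D.σ^[k] ω) (j - k) ∘ D.iterT ω k := by
      rw [← D.iterT_add, Nat.add_sub_cancel' hkj]
    simp only [e, ← MeasurableSpace.comap_comp]
    exact MeasurableSpace.comap_mono (mT _ _).comap_le
  · exact fun k => (hφ _).comp (comap_measurable _)
  · intro k x
    -- `Decorrelated` asks for a bound at every point, while the Lipschitz norm sees only the fibre;
    -- vanishing off the fibre closes the difference.
    by_cases hx : D.iterT ω k x ∈ D.fiber (D.σ^[k] ω)
    · have := abs_le_lipNorm (hlip k) hx
      linarith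
    · simp only [hφ0 _ _ hx, abs_zero]
      positivity
  · intro k
    positivity
  · intro k j hkj g hgm C hC
    obtain ⟨f, hf, rfl, hfC⟩ := hg j g hgm C hC
    -- The case l = i = k with g₁ = 1. The product of means vanishes since φ is centred, and 1 +
    -- ‖1‖_Lip ≤ 2 is the source of the factor 2 in A.
    have h1 : lipNorm (D.fiber (D.σ^[k] ω)) (fun _ => (1 : ℝ)) ≠ ∞ :=
      ((lipNorm_one_le _).trans_lt ENNReal.one_lt_top).ne
    have := hM.norm_sub_le hT hE hs ha le_rfl hkj measurable_const (hφ (D.σ^[k] ω)) h1 (hlip k)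
      hf hfC
    simp only [Complex.ofReal_one, one_mul, hmean' k, Complex.ofReal_zero, zero_mul,
      sub_zero] at this
    refine this.trans ?_
    have hC0 : 0 ≤ C := by
      obtain ⟨x, hx⟩ := hfC.exists
      exact (norm_nonneg _).trans hx
    have h2 : (lipNorm (D.fiber (D.σ^[k] ω)) (fun _ => (1 : ℝ))).toReal ≤ 1 :=
      ENNReal.toReal_le_of_le_ofReal zero_le_one (by simpa using lipNorm_one_le _)
    have h3 := ha (j - k)
    calc _ ≤ |K (D.σ^[k] ω)| * a (j - k) * (1 + 1)
          * (1 + (lipNorm (D.fiber (D.σ^[k] ω)) (φ (D.σ^[k] ω))).toReal) * C := by gcongr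
      _ = _ := by ring
  · intro l i j hli hij g hgm C hC
    obtain ⟨f, hf, rfl, hfC⟩ := hg j g hgm C hC
    have := hM.norm_sub_le hT hE hs ha hli hij (hφ (D.σ^[l] ω)) (hφ (D.σ^[i] ω)) (hlip l) (hlip i)
      hf hfC
    refine this.trans ?_
    have hC0 : 0 ≤ C := by
      obtain ⟨x, hx⟩ := hfC.exists
      exact (norm_nonneg _).trans hx
    have h3 := ha (j - i)
    set N₁ := 1 + (lipNorm (D.fiber (D.σ^[l] ω)) (φ (D.σ^[l] ω))).toReal with hN₁
    set N₂ := 1 + (lipNorm (D.fiber (D.σ^[i] ω)) (φ (D.σ^[i] ω))).toReal with hN₂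
    have hN₁' : 0 ≤ N₁ := by positivity
    have hN₂' : 0 ≤ N₂ := by positivity
    have : 0 ≤ |K (D.σ^[i] ω)| * a (j - i) * N₁ * N₂ * C := by positivity
    calc _ ≤ 2 * (|K (D.σ^[i] ω)| * a (j - i) * N₁ * N₂ * C) := by linarith
      _ = _ := by ring

end RandomSystem

/-! ### Limit of the normalized variances. -/

lemma exists_sum_le_mul_of_tendsto {x : ℕ → ℝ} {c : ℝ}
    (h : Tendsto (fun n : ℕ => (∑ k ∈ Finset.range n, x k) / n) atTop (𝓝 c)) :
    ∃ Q : ℝ, ∀ n : ℕ, ∑ k ∈ Finset.range n, x k ≤ Q * n := by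
  obtain ⟨Q, hQ⟩ := h.bddAbove_range
  refine ⟨Q, fun n => ?_⟩
  rcases Nat.eq_zero_or_pos n with rfl | hn
  · simp
  · have hn0 : (0 : ℝ) < n := by exact_mod_cast hn
    rw [← div_le_iff₀ hn0]
    exact hQ ⟨n, rfl⟩

lemma tendsto_sum_range_sub_div {x : ℕ → ℝ} {c : ℝ} (d : ℕ)
    (h : Tendsto (fun n : ℕ => (∑ k ∈ Finset.range n, x k) / n) atTop (𝓝 c)) :
    Tendsto (fun n : ℕ => (∑ k ∈ Finset.range (n - d), x k) / n) atTop (𝓝 c) := by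
  rw [← tendsto_add_atTop_iff_nat d]
  have h2 : Tendsto (fun n : ℕ => (n : ℝ) / (n + d)) atTop (𝓝 1) :=
    tendsto_natCast_div_add_atTop (d : ℝ)
  have h3 := h.mul h2
  rw [mul_one] at h3
  refine h3.congr' ?_
  filter_upwards [eventually_ge_atTop 1] with n hn
  have hn0 : (n : ℝ) ≠ 0 := by positivity
  rw [Nat.add_sub_cancel]
  push_cast
  field_simp

/-- The limit of the normalized variances, from the limits of the averaged correlations. -/
lemma tendsto_variance_of_tendsto_correlation {c : ℕ → ℕ → ℝ} {γ N A a : ℕ → ℝ} {Q : ℝ}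
    (ha : Summable a) (ha0 : ∀ d, 0 ≤ a d)
    (hc : ∀ d, Tendsto (fun n : ℕ => (∑ k ∈ Finset.range n, c d k) / n) atTop (𝓝 (γ d)))
    (hcb : ∀ d k, |c d k| ≤ a d * (A k * N (k + d)))
    (hN2 : ∀ n : ℕ, ∑ k ∈ Finset.range n, N k ^ 2 ≤ Q * n)
    (hA2 : ∀ n : ℕ, ∑ k ∈ Finset.range n, A k ^ 2 ≤ Q * n) :
    Tendsto (fun n : ℕ => 1 / (n : ℝ)
      * (2 * ∑ k ∈ Finset.range n, ∑ j ∈ Finset.Ico k n, diagHalf k j * c (j - k) k)) atTop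
      (𝓝 (∑' d, 2 * diagHalf 0 d * γ d)) := by
  -- The double sum grouped by lag and extended by zero, so that dominated convergence for series
  -- applies with majorant 2Q a_d. The weight `2 * diagHalf 0 d` is 1 at lag 0 and 2 elsewhere, as
  -- in the Green–Kubo formula.
  set f : ℕ → ℕ → ℝ := fun n d => if d < n then
    2 * diagHalf 0 d * ((∑ k ∈ Finset.range (n - d), c d k) / n) else 0 with hf
  have hsum : ∀ n : ℕ, 1 / (n : ℝ)
      * (2 * ∑ k ∈ Finset.range n, ∑ j ∈ Finset.Ico k n, diagHalf k j * c (j - k) k)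
      = ∑' d, f n d := by
    intro n
    rw [tsum_eq_sum (s := Finset.range n) fun d hd => if_neg (by simpa using hd),
      sum_range_sum_Ico, Finset.mul_sum, Finset.mul_sum]
    refine Finset.sum_congr rfl fun d hd => ?_
    have e : ∀ k, diagHalf k (k + d) = diagHalf 0 d := fun k => by simp [diagHalf]
    simp only [if_pos (Finset.mem_range.1 hd), e, Nat.add_sub_cancel_left, ← Finset.mul_sum]
    ring
  simp_rw [hsum]
  refine tendsto_tsum_of_dominated_convergence (bound := fun d => 2 * Q * a d) (ha.mul_left _)
    (fun d => ?_) ?_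
  · refine Tendsto.congr' ?_ ((tendsto_sum_range_sub_div d (hc d)).const_mul (2 * diagHalf 0 d))
    filter_upwards [eventually_gt_atTop d] with n hn
    rw [hf]
    simp only [if_pos hn]
  · filter_upwards [eventually_ge_atTop 1] with n hn d
    have hn0 : (0 : ℝ) < n := by exact_mod_cast hn
    have hQ0 : 0 ≤ Q := by
      have := hN2 1
      simp only [Finset.sum_range_one, Nat.cast_one, mul_one] at this
      exact (sq_nonneg _).trans this
    simp only [hf]
    split_ifs
    · have h1 : |∑ k ∈ Finset.range (n - d), c d k| ≤ a d * (Q * n) := by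
        refine (Finset.abs_sum_le_sum_abs _ _).trans
          ((Finset.sum_le_sum fun k _ => hcb d k).trans ?_)
        rw [← Finset.mul_sum]
        exact mul_le_mul_of_nonneg_left (sum_mul_shift_le (hA2 n) (hN2 n)) (ha0 d)
      rw [Real.norm_eq_abs, abs_mul, abs_mul, abs_div, abs_of_pos hn0, abs_two,
        abs_of_nonneg (diagHalf_nonneg 0 d)]
      have h2 : |∑ k ∈ Finset.range (n - d), c d k| / n ≤ a d * Q := by
        rw [div_le_iff₀ hn0]
        linarith
      have h3 := diagHalf_le_one 0 d
      have h4 := diagHalf_nonneg 0 d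
      have h5 := ha0 d
      calc _ ≤ 2 * 1 * (a d * Q) := by gcongr
        _ = _ := by ring
    · have := ha0 d
      rw [norm_zero]
      positivity

namespace RandomSystem

variable {Ω M : Type*} [MeasurableSpace Ω] [MetricSpace M] [MeasurableSpace M] [BorelSpace M]
  {P : Measure Ω} {D : RandomSystem Ω M P} {s p r : ℝ} {K : Ω → ℝ} {a : ℕ → ℝ} {φ : Ω → M → ℝ}

lemma ae_forall_iterate (D : RandomSystem Ω M P) {q : Ω → Prop} (h : ∀ᵐ ω ∂P, q ω) :
    ∀ᵐ ω ∂P, ∀ k, q (D.σ^[k] ω) :=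
  ae_all_iff.2 fun k => (D.ergodic.toMeasurePreserving.iterate k).quasiMeasurePreserving.ae h

lemma measurable_iterT_prod (hT : Measurable fun z : Ω × M => D.T z.1 z.2) (n : ℕ) :
    Measurable fun z : Ω × M => D.iterT z.1 n z.2 := by
  induction n with
  | zero => exact measurable_snd
  | succ n ih =>
    exact hT.comp (((D.ergodic.measurable.iterate n).comp measurable_fst).prodMk ih)

/-- The correlation `∫ φ_ω · (φ_{σ^d ω} ∘ T_ω^d) dμ_ω`. -/
def correlation (D : RandomSystem Ω M P) (φ : Ω → M → ℝ) (d : ℕ) (ω : Ω) : ℝ :=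
  ∫ x, φ ω x * φ (D.σ^[d] ω) (D.iterT ω d x) ∂(D.μ ω)

lemma stronglyMeasurable_correlation (hT : Measurable fun z : Ω × M => D.T z.1 z.2)
    (hφ : Measurable fun z : Ω × M => φ z.1 z.2) (d : ℕ) :
    StronglyMeasurable (D.correlation φ d) := by
  refine StronglyMeasurable.integral_kernel_prod_right' (κ := D.μ)
    (f := fun z : Ω × M => φ z.1 z.2 * φ (D.σ^[d] z.1) (D.iterT z.1 d z.2)) ?_
  exact (hφ.mul (hφ.comp (((D.ergodic.measurable.iterate d).comp measurable_fst).prodMk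
    (measurable_iterT_prod hT d)))).stronglyMeasurable

/-- Hölder with 1/q = 1/p + 1/r puts the product in L^q, and q ≥ 2 on a probability space. This is
where the moment condition makes A² integrable. -/
lemma memLp_two_mul [IsProbabilityMeasure P] (hp : 0 < p) (hr : 0 < r)
    (hpr : 1 / p + 1 / r ≤ 1 / 2) {f g : Ω → ℝ} (hf : MemLp f (ENNReal.ofReal p) P)
    (hg : MemLp g (ENNReal.ofReal r) P) : MemLp (fun ω => f ω * g ω) 2 P := by
  set q := (p⁻¹ + r⁻¹)⁻¹ with hq
  have hq0 : 0 < q := by positivity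
  have hq2 : 2 ≤ q := by
    rw [hq, le_inv_comm₀ (by norm_num) (by positivity)]
    simpa [one_div] using hpr
  have hH : ENNReal.HolderTriple (ENNReal.ofReal p) (ENNReal.ofReal r) (ENNReal.ofReal q) := by
    refine ⟨?_⟩
    rw [← ENNReal.ofReal_inv_of_pos hp, ← ENNReal.ofReal_inv_of_pos hr,
      ← ENNReal.ofReal_inv_of_pos hq0, ← ENNReal.ofReal_add (by positivity) (by positivity), hq,
      inv_inv]
  have h : MemLp (fun ω => f ω * g ω) (ENNReal.ofReal q) P := hg.mul' hf
  refine h.mono_exponent ?_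
  rw [← ENNReal.ofReal_ofNat]
  exact ENNReal.ofReal_le_ofReal hq2

end RandomSystem

/-! ### The quenched theorem for jointly measurable data. -/

/-- Convergence of the characteristic functions of `S_n / √n`, for bounded `X k`. -/
lemma tendstoInDistribution_of_tendsto_tailExp {S : Type*} [MeasurableSpace S] {μ : Measure S}
    [IsProbabilityMeasure μ] {X : ℕ → S → ℝ} (hX : ∀ k, Measurable (X k)) {V : ℝ≥0}
    (h : ∀ t : ℝ, Tendsto (fun n : ℕ => ∫ ω, tailExp X (t / √(n : ℝ)) n 0 ω ∂μ) atTop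
      (𝓝 (Real.exp (-(t ^ 2 * ((V : ℝ) / 2))) : ℂ))) :
    TendstoInDistribution (fun (n : ℕ) x => 1 / √(n : ℝ) * ∑ k ∈ Finset.range n, X k x) atTop
      (id : ℝ → ℝ) (fun _ => μ) (gaussianReal 0 V) := by
  have hm : ∀ n : ℕ, Measurable fun x => 1 / √(n : ℝ) * ∑ k ∈ Finset.range n, X k x :=
    fun n => (Finset.measurable_fun_sum _ fun k _ => hX k).const_mul _
  refine ⟨fun n => (hm n).aemeasurable, aemeasurable_id, ?_⟩
  refine ProbabilityMeasure.tendsto_iff_tendsto_charFun.2 fun t => ?_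
  have e : charFun ((gaussianReal 0 V).map id) t = (Real.exp (-(t ^ 2 * ((V : ℝ) / 2))) : ℂ) := by
    rw [Measure.map_id, charFun_gaussianReal]
    push_cast
    congr 1
    ring
  refine ((h t).congr fun n => ?_).trans_eq (congrArg 𝓝 e.symm)
  change _ = charFun (μ.map fun x => 1 / √(n : ℝ) * ∑ k ∈ Finset.range n, X k x) t
  rw [charFun_apply_real, integral_map (hm n).aemeasurable (by fun_prop)]
  refine integral_congr_ae (ae_of_all _ fun x => ?_)
  simp only [tailExp, ← Finset.range_eq_Ico]
  congr 1
  push_cast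
  ring

lemma lipNorm_congr {M : Type*} [MetricSpace M] {F : Set M} {g h : M → ℝ} (e : Set.EqOn g h F) :
    lipNorm F g = lipNorm F h := by
  unfold lipNorm
  congr 1
  · exact iSup_congr fun x => iSup_congr fun hx => by rw [e hx]
  · exact iSup_congr fun x => iSup_congr fun hx => iSup_congr fun y => iSup_congr fun hy => by
      rw [e hx, e hy]

namespace RandomSystem

variable {Ω M : Type*} [MeasurableSpace Ω] [MetricSpace M] [MeasurableSpace M] [BorelSpace M]
  {P : Measure Ω}

/-- The conclusion of the quenched central limit theorem at the point `ω`. -/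
structure CLTAt (D : RandomSystem Ω M P) (φ : Ω → M → ℝ) (V : ℝ≥0) (ω : Ω) : Prop where
  integrable : ∀ n : ℕ, Integrable (fun x => D.birkhoff φ ω n x ^ 2) (D.μ ω)
  variance : Tendsto (fun n : ℕ => 1 / (n : ℝ) * ∫ x, D.birkhoff φ ω n x ^ 2 ∂(D.μ ω)) atTop
    (𝓝 (V : ℝ))
  clt : TendstoInDistribution (fun (n : ℕ) x => 1 / √(n : ℝ) * D.birkhoff φ ω n x) atTop
    (id : ℝ → ℝ) (fun _ => D.μ ω) (gaussianReal 0 V)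

lemma CLTAt.congr {D D' : RandomSystem Ω M P} {φ φ' : Ω → M → ℝ} {V : ℝ≥0} {ω : Ω}
    (h : D.CLTAt φ V ω) (hμ : D'.μ = D.μ)
    (e : ∀ᵐ x ∂(D.μ ω), ∀ n, D.birkhoff φ ω n x = D'.birkhoff φ' ω n x) : D'.CLTAt φ' V ω := by
  have e' : ∀ n, ∀ᵐ x ∂(D.μ ω), D.birkhoff φ ω n x = D'.birkhoff φ' ω n x := ae_all_iff.1 e
  obtain ⟨h1, h2, h3⟩ := h
  have hsq : ∀ n, (fun x => D.birkhoff φ ω n x ^ 2) =ᵐ[D.μ ω] fun x => D'.birkhoff φ' ω n x ^ 2 :=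
    fun n => by filter_upwards [e' n] with x hx using by rw [hx]
  refine ⟨fun n => ?_, ?_, ?_⟩
  · rw [hμ]
    exact (h1 n).congr (hsq n)
  · rw [hμ]
    refine h2.congr fun n => ?_
    rw [integral_congr_ae (hsq n)]
  · simp only [hμ]
    refine h3.congr (fun n => ?_) EventuallyEq.rfl
    filter_upwards [e' n] with x hx using by rw [hx]

variable {D : RandomSystem Ω M P} {s p r : ℝ} {K : Ω → ℝ} {a : ℕ → ℝ} {φ : Ω → M → ℝ}

lemma MemoryLoss.ae_memoryLossAt (hD : D.MemoryLoss s p K a) :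
    ∀ᵐ ω ∂P, D.MemoryLossAt s K a ω :=
  hD.bound

lemma ae_equivariantAt (D : RandomSystem Ω M P) : ∀ᵐ ω ∂P, D.EquivariantAt ω := by
  filter_upwards [D.ae_forall_iterate D.equivariant] with ω hω k
  rw [hω k, Function.iterate_succ_apply']

lemma birkhoff_limits_of_decorrelated (hT : ∀ ω, Measurable (D.T ω)) (hφ : ∀ ω, Measurable (φ ω))
    (ha : Summable a) {ω : Ω} {N A γ : ℕ → ℝ} {cN cA : ℝ} {ℱ : ℕ → MeasurableSpace M}
    (hω : Decorrelated (D.μ ω) (fun k x => φ (D.σ^[k] ω) (D.iterT ω k x)) ℱ N A a)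
    (hcω : ∀ d k, |D.correlation φ d (D.σ^[k] ω)| ≤ a d * (A k * N (k + d)))
    (hBcω : ∀ d, Tendsto (fun n : ℕ => (∑ k ∈ Finset.range n, D.correlation φ d (D.σ^[k] ω)) / n)
      atTop (𝓝 (γ d)))
    (hBNω : Tendsto (fun n : ℕ => (∑ k ∈ Finset.range n, N k ^ 2) / n) atTop (𝓝 cN))
    (hBAω : Tendsto (fun n : ℕ => (∑ k ∈ Finset.range n, A k ^ 2) / n) atTop (𝓝 cA))
    (hEω : D.EquivariantAt ω) :
    (∀ n : ℕ, Integrable (fun x => D.birkhoff φ ω n x ^ 2) (D.μ ω)) ∧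
      Tendsto (fun n : ℕ => 1 / (n : ℝ) * ∫ x, D.birkhoff φ ω n x ^ 2 ∂(D.μ ω)) atTop
        (𝓝 (∑' d, 2 * diagHalf 0 d * γ d)) ∧
      ∀ t : ℝ, Tendsto (fun n : ℕ => ∫ x, tailExp (fun k x => φ (D.σ^[k] ω) (D.iterT ω k x))
        (t / √(n : ℝ)) n 0 x ∂(D.μ ω)) atTop
        (𝓝 (Real.exp (-(t ^ 2 * ((∑' d, 2 * diagHalf 0 d * γ d) / 2))) : ℂ)) := by
  have mT := D.measurable_iterT hT
  obtain ⟨Q₁, hQ₁⟩ := exists_sum_le_mul_of_tendsto hBNω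
  obtain ⟨Q₂, hQ₂⟩ := exists_sum_le_mul_of_tendsto hBAω
  have hQ₁' : ∀ n : ℕ, ∑ k ∈ Finset.range n, N k ^ 2 ≤ max Q₁ Q₂ * n := fun n =>
    (hQ₁ n).trans (mul_le_mul_of_nonneg_right (le_max_left _ _) (Nat.cast_nonneg n))
  have hQ₂' : ∀ n : ℕ, ∑ k ∈ Finset.range n, A k ^ 2 ≤ max Q₁ Q₂ * n := fun n =>
    (hQ₂ n).trans (mul_le_mul_of_nonneg_right (le_max_right _ _) (Nat.cast_nonneg n))
  set X : ℕ → M → ℝ := fun k x => φ (D.σ^[k] ω) (D.iterT ω k x) with hX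
  have hXX : ∀ k j, Integrable (fun x => X k x * X j x) (D.μ ω) := fun k j => by
    refine Integrable.of_bound ((hω.measurable k).mul (hω.measurable j)).aestronglyMeasurable
      (N k * N j) (ae_of_all _ fun x => ?_)
    rw [norm_mul]
    exact mul_le_mul (hω.bound k x) (hω.bound j x) (norm_nonneg _)
      ((abs_nonneg _).trans (hω.bound k x))
  have hsq : ∀ n x, D.birkhoff φ ω n x ^ 2
      = 2 * ∑ k ∈ Finset.range n, ∑ j ∈ Finset.Ico k n, diagHalf k j * (X k x * X j x) := by
    intro n x
    rw [sum_diagHalf_mul (fun k => X k x)]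
    simp only [birkhoff, hX]
    ring
  have hcorr : ∀ k j, k ≤ j →
      ∫ x, X k x * X j x ∂(D.μ ω) = D.correlation φ (j - k) (D.σ^[k] ω) := by
    intro k j hkj
    have hm : Measurable fun y => φ (D.σ^[k] ω) y
        * φ (D.σ^[j] ω) (D.iterT (D.σ^[k] ω) (j - k) y) :=
      (hφ _).mul ((hφ _).comp (mT _ _))
    rw [correlation, iterate_sub_iterate hkj,
      ← hEω.integral_comp_iterT hT k hm.aestronglyMeasurable]
    simp only [hX, iterT_sub_iterT hkj]
  have hint : ∀ n, Integrable (fun x => D.birkhoff φ ω n x ^ 2) (D.μ ω) := by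
    intro n
    simp_rw [hsq]
    exact (integrable_finsetSum _ fun k _ => integrable_finsetSum _ fun j _ =>
      (hXX k j).const_mul _).const_mul 2
  have hvar : Tendsto (fun n : ℕ => 1 / (n : ℝ) * ∫ x, D.birkhoff φ ω n x ^ 2 ∂(D.μ ω)) atTop
      (𝓝 (∑' d, 2 * diagHalf 0 d * γ d)) := by
    have h1 := tendsto_variance_of_tendsto_correlation
      (c := fun d k => D.correlation φ d (D.σ^[k] ω)) (N := N)
      (A := A) ha hω.a_nonneg hBcω hcω hQ₁' hQ₂'
    refine h1.congr fun n => ?_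
    simp_rw [hsq]
    rw [integral_const_mul, integral_finsetSum _ fun k _ => integrable_finsetSum _ fun j _ =>
      (hXX k j).const_mul _]
    congr 2
    refine Finset.sum_congr rfl fun k _ => ?_
    rw [integral_finsetSum _ fun j _ => (hXX k j).const_mul _]
    refine Finset.sum_congr rfl fun j hj => ?_
    rw [integral_const_mul, hcorr k j (Finset.mem_Ico.1 hj).1]
  exact ⟨hint, hvar, fun t => hω.tendsto_charFun ha hQ₁' hQ₂'
    (tendsto_div_of_tendsto_sum_div hBNω) (tendsto_div_of_tendsto_sum_div hBAω) hvar t⟩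

/-- The quenched central limit theorem when the fibre maps and the observable are measurable on
the whole of `Ω × M`. -/
theorem exists_ae_cltAt_of_measurable [IsProbabilityMeasure P] (hs : 1 ≤ s) (hp : 0 < p)
    (hr : 0 < r) (hD : D.MemoryLoss s p K a) (hT : Measurable fun z : Ω × M => D.T z.1 z.2)
    (hφ : Measurable fun z : Ω × M => φ z.1 z.2) (hφ0 : ∀ ω, ∀ x ∉ D.fiber ω, φ ω x = 0)
    (hmean : ∀ᵐ ω ∂P, ∫ x, φ ω x ∂(D.μ ω) = 0)
    (hlip : ∀ᵐ ω ∂P, lipNorm (D.fiber ω) (φ ω) ≠ ∞)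
    (hLr : MemLp (fun ω => (lipNorm (D.fiber ω) (φ ω)).toReal) (ENNReal.ofReal r) P)
    (hpr : 1 / p + 1 / r ≤ 1 / 2) (ha : Summable a) :
    ∃ V : ℝ≥0, ∀ᵐ ω ∂P, D.CLTAt φ V ω := by
  have hTω : ∀ ω, Measurable (D.T ω) := fun ω => hT.comp measurable_prodMk_left
  have hφω : ∀ ω, Measurable (φ ω) := fun ω => hφ.comp measurable_prodMk_left
  have mT := D.measurable_iterT hTω
  have ha0 : ∀ n, 0 ≤ a n := fun n => (hD.pos n).le
  set N : Ω → ℝ := fun ω => 1 + (lipNorm (D.fiber ω) (φ ω)).toReal with hN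
  set A : Ω → ℝ := fun ω => 2 * (|K ω| * N ω) with hA
  have hN1 : MemLp (fun _ : Ω => (1 : ℝ)) (ENNReal.ofReal r) P := memLp_const 1
  have hNr : MemLp N (ENNReal.ofReal r) P := hN1.add hLr
  have hr2 : 2 ≤ r := by
    have h1 : 0 < 1 / p := by positivity
    have h2 : 1 / r ≤ 1 / 2 := by linarith
    exact (one_div_le_one_div hr two_pos).1 h2
  have hN2 : MemLp N 2 P := by
    refine hNr.mono_exponent ?_
    rw [← ENNReal.ofReal_ofNat]
    exact ENNReal.ofReal_le_ofReal hr2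
  have hA2 : MemLp A 2 P := (memLp_two_mul hp hr hpr hD.memLp.abs hNr).const_mul 2
  have hdec : ∀ᵐ ω ∂P, Decorrelated (D.μ ω) (fun k x => φ (D.σ^[k] ω) (D.iterT ω k x))
      (fun k => MeasurableSpace.comap (D.iterT ω k) inferInstance)
      (fun k => N (D.σ^[k] ω)) (fun k => A (D.σ^[k] ω)) a := by
    filter_upwards [hD.ae_memoryLossAt, D.ae_equivariantAt, D.ae_forall_iterate hmean,
      D.ae_forall_iterate hlip] with ω h1 h2 h3 h4
    exact h1.decorrelated hTω h2 hs ha0 hD.antitone hφω hφ0 h3 h4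
  have hcb : ∀ᵐ ω ∂P, ∀ d, |D.correlation φ d ω| ≤ a d * (A ω * N (D.σ^[d] ω)) := by
    filter_upwards [hdec] with ω hω d
    have h := hω.abs_integral_mul_le (Nat.zero_le d)
    simp only [Function.iterate_zero, id_eq, iterT, Nat.sub_zero] at h
    exact h
  have hci : ∀ d, Integrable (D.correlation φ d) P := by
    intro d
    have h1 : Integrable (fun ω => A ω * N (D.σ^[d] ω)) P :=
      hA2.integrable_mul (hN2.comp_measurePreserving (D.ergodic.toMeasurePreserving.iterate d))
    refine (h1.const_mul (a d)).mono'
      (stronglyMeasurable_correlation hT hφ d).aestronglyMeasurable ?_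
    filter_upwards [hcb] with ω hω using hω d
  have hBc := ae_all_iff.2 fun d => tendsto_birkhoffSum_div D.ergodic (hci d)
  have hBN := tendsto_birkhoffSum_div D.ergodic hN2.integrable_sq
  have hBA := tendsto_birkhoffSum_div D.ergodic hA2.integrable_sq
  obtain ⟨V₀, main⟩ : ∃ V₀ : ℝ, ∀ᵐ ω ∂P,
      (∀ n : ℕ, Integrable (fun x => D.birkhoff φ ω n x ^ 2) (D.μ ω)) ∧
      Tendsto (fun n : ℕ => 1 / (n : ℝ) * ∫ x, D.birkhoff φ ω n x ^ 2 ∂(D.μ ω)) atTop (𝓝 V₀) ∧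
      ∀ t : ℝ, Tendsto (fun n : ℕ => ∫ x, tailExp (fun k x => φ (D.σ^[k] ω) (D.iterT ω k x))
        (t / √(n : ℝ)) n 0 x ∂(D.μ ω)) atTop (𝓝 (Real.exp (-(t ^ 2 * (V₀ / 2))) : ℂ)) := by
    -- The limit is built from `P`-averages of the correlations, hence does not depend on `ω`.
    refine ⟨∑' d, 2 * diagHalf 0 d * ∫ ω, D.correlation φ d ω ∂P, ?_⟩
    filter_upwards [hdec, D.ae_forall_iterate hcb, hBc, hBN, hBA, D.ae_equivariantAt]
      with ω hω hcω hBcω hBNω hBAω hEω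
    refine birkhoff_limits_of_decorrelated hTω hφω ha hω (fun d k => ?_) hBcω hBNω hBAω hEω
    have := hcω k d
    rwa [← Function.iterate_add_apply, add_comm d k] at this
  have hV₀0 : 0 ≤ V₀ := by
    obtain ⟨ω, -, h, -⟩ := main.exists
    exact ge_of_tendsto' h fun n =>
      mul_nonneg (by positivity) (integral_nonneg fun x => sq_nonneg _)
  lift V₀ to ℝ≥0 using hV₀0
  refine ⟨V₀, ?_⟩
  filter_upwards [main] with ω ⟨h1, h2, h3⟩
  exact ⟨h1, h2, tendstoInDistribution_of_tendsto_tailExp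
    (fun k => (hφω _).comp (mT ω k)) h3⟩

/-! ### Extension off the fibres and the general case. -/

open Classical in
/-- The system with the fibre maps replaced by the identity off the fibres. -/
def extend (D : RandomSystem Ω M P) : RandomSystem Ω M P where
  σ := D.σ
  ergodic := D.ergodic
  fiber := D.fiber
  isClosed_fiber := D.isClosed_fiber
  measurableSet_total := D.measurableSet_total
  T ω x := if x ∈ D.fiber ω then D.T ω x else x
  mapsTo ω x hx := by simpa only [if_pos hx] using D.mapsTo ω hx
  measurable_T := by
    convert D.measurable_T using 2 with z
    exact if_pos z.2
  μ := D.μ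
  isMarkov := D.isMarkov
  measure_compl_fiber := D.measure_compl_fiber
  equivariant := by
    filter_upwards [D.equivariant] with ω hω
    rw [← hω]
    refine Measure.map_congr ?_
    filter_upwards [D.ae_mem_fiber ω] with x hx using if_pos hx

end RandomSystem

/-- The measures g⁺μ and g⁻μ are absolutely continuous with respect to μ, so their images ignore
changes of the map on μ-null sets. Hence the memory loss hypothesis survives the extension off the
fibres. -/
lemma transferOperator_congr {M : Type*} [MeasurableSpace M] {T T' : M → M} {μ : Measure M}
    (h : T =ᵐ[μ] T') (ν : Measure M) (g : M → ℝ) :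
    transferOperator T μ ν g = transferOperator T' μ ν g := by
  have e : ∀ f : M → ℝ≥0∞, (μ.withDensity f).map T = (μ.withDensity f).map T' := fun f =>
    Measure.map_congr ((withDensity_absolutelyContinuous μ f).ae_eq h)
  funext x
  rw [transferOperator, transferOperator, e, e]

namespace RandomSystem

variable {Ω M : Type*} [MeasurableSpace Ω] [MetricSpace M] [MeasurableSpace M] [BorelSpace M]
  {P : Measure Ω} (D : RandomSystem Ω M P)

lemma extend_T_of_mem {ω : Ω} {x : M} (hx : x ∈ D.fiber ω) : D.extend.T ω x = D.T ω x :=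
  if_pos hx

lemma measurable_extend_T : Measurable fun z : Ω × M => D.extend.T z.1 z.2 := by
  classical
  exact Measurable.dite (s := {z : Ω × M | z.2 ∈ D.fiber z.1})
    (f := fun z => D.T z.1.1 z.1.2) D.measurable_T
    (g := fun z => z.1.2) (measurable_snd.comp measurable_subtype_coe) D.measurableSet_total

lemma iterL_extend (ω : Ω) (n : ℕ) : D.extend.iterL ω n = D.iterL ω n := by
  have h : ∀ ω, D.extend.L ω = D.L ω := fun ω => funext fun g =>
    transferOperator_congr
      (by filter_upwards [D.ae_mem_fiber ω] with x hx using D.extend_T_of_mem hx) _ g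
  induction n with
  | zero => rfl
  | succ n ih =>
    simp only [iterL, ih, h]
    rfl

lemma iterT_mem_fiber {ω : Ω} {x : M} (hx : x ∈ D.fiber ω) (n : ℕ) :
    D.iterT ω n x ∈ D.fiber (D.σ^[n] ω) := by
  induction n with
  | zero => exact hx
  | succ n ih =>
    rw [Function.iterate_succ_apply']
    exact D.mapsTo _ ih

lemma iterT_extend {ω : Ω} {x : M} (hx : x ∈ D.fiber ω) (n : ℕ) :
    D.extend.iterT ω n x = D.iterT ω n x := by
  induction n with
  | zero => rfl
  | succ n ih =>
    simp only [iterT, Function.comp_apply, ih]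
    exact D.extend_T_of_mem (D.iterT_mem_fiber hx n)

lemma MemoryLoss.extend {D : RandomSystem Ω M P} {s p : ℝ} {K : Ω → ℝ} {a : ℕ → ℝ}
    (h : D.MemoryLoss s p K a) : D.extend.MemoryLoss s p K a := by
  refine ⟨h.memLp, h.pos, h.antitone, h.tendsto, ?_⟩
  simp only [iterL_extend]
  exact h.bound

/-- The quenched central limit theorem under summable quenched memory loss. -/
theorem exists_ae_cltAt [IsProbabilityMeasure P] {D : RandomSystem Ω M P} {s p r : ℝ}
    {K : Ω → ℝ} {a : ℕ → ℝ} {φ : Ω → M → ℝ} (hs : 1 ≤ s) (hp : 0 < p)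
    (hr : 0 < r) (hD : D.MemoryLoss s p K a)
    (hφ : Measurable fun z : D.total => φ z.1.1 z.1.2)
    (hmean : ∀ᵐ ω ∂P, ∫ x, φ ω x ∂(D.μ ω) = 0)
    (hlip : ∀ᵐ ω ∂P, lipNorm (D.fiber ω) (φ ω) ≠ ∞)
    (hLr : MemLp (fun ω => (lipNorm (D.fiber ω) (φ ω)).toReal) (ENNReal.ofReal r) P)
    (hpr : 1 / p + 1 / r ≤ 1 / 2) (ha : Summable a) :
    ∃ V : ℝ≥0, ∀ᵐ ω ∂P, D.CLTAt φ V ω := by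
  classical
  -- Extension by zero gives joint measurability on Ω × M. Fibres carry the measures and are mapped
  -- into fibres, so the Birkhoff sums change only on a null set.
  set ψ : Ω → M → ℝ := fun ω x => if x ∈ D.fiber ω then φ ω x else 0 with hψ
  have hψφ : ∀ ω, Set.EqOn (φ ω) (ψ ω) (D.fiber ω) := fun ω x hx => (if_pos hx).symm
  have hlip' : ∀ ω, lipNorm (D.fiber ω) (φ ω) = lipNorm (D.fiber ω) (ψ ω) :=
    fun ω => lipNorm_congr (hψφ ω)
  have hψm : Measurable fun z : Ω × M => ψ z.1 z.2 :=
    Measurable.dite (s := D.total) (f := fun z => φ z.1.1 z.1.2) hφ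
      (g := fun _ => (0 : ℝ)) measurable_const D.measurableSet_total
  simp only [hlip'] at hlip hLr
  obtain ⟨V, hV⟩ := exists_ae_cltAt_of_measurable (D := D.extend) (φ := ψ) hs hp hr hD.extend
    D.measurable_extend_T hψm (fun ω x hx => if_neg hx)
    (by
      filter_upwards [hmean] with ω hω
      rw [← hω]
      refine integral_congr_ae ?_
      filter_upwards [D.ae_mem_fiber ω] with x hx using (hψφ ω hx).symm)
    hlip hLr hpr ha
  refine ⟨V, ?_⟩
  filter_upwards [hV] with ω hω
  refine hω.congr rfl ?_
  filter_upwards [D.extend.ae_mem_fiber ω] with x hx n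
  refine Finset.sum_congr rfl fun k _ => ?_
  rw [D.iterT_extend hx]
  exact (hψφ _ (D.iterT_mem_fiber hx k)).symm

end RandomSystem

end RandomCLT

end

theorem mainTheorem5 {Ω M : Type*} [MeasurableSpace Ω] [MetricSpace M] [MeasurableSpace M]
    [BorelSpace M] (P : Measure Ω) [IsProbabilityMeasure P]
    (D : RandomCLT.RandomSystem Ω M P)
    (s p r : ℝ) (hs : 1 ≤ s) (hp : 0 < p) (hr : 0 < r)
    (K : Ω → ℝ) (a : ℕ → ℝ) (hD : D.MemoryLoss s p K a)
    (φ : Ω → M → ℝ) (hφ_meas : Measurable fun z : D.total => φ z.1.1 z.1.2)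
    (hφ_mean : ∀ᵐ ω ∂P, ∫ x, φ ω x ∂(D.μ ω) = 0)
    (hφ_lip : ∀ᵐ ω ∂P, RandomCLT.lipNorm (D.fiber ω) (φ ω) ≠ ∞)
    (hφ_Lr : MemLp (fun ω => (RandomCLT.lipNorm (D.fiber ω) (φ ω)).toReal) (ENNReal.ofReal r) P)
    (hpr : 1 / p + 1 / r ≤ 1 / 2) (ha : Summable a) :
    ∃ V : ℝ≥0,
      (∀ᵐ ω ∂P,
        (∀ n : ℕ, Integrable (fun x => D.birkhoff φ ω n x ^ 2) (D.μ ω)) ∧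
        Tendsto (fun n : ℕ => 1 / (n : ℝ) * ∫ x, D.birkhoff φ ω n x ^ 2 ∂(D.μ ω)) atTop
          (𝓝 (V : ℝ))) ∧
      (∀ᵐ ω ∂P,
        TendstoInDistribution (fun (n : ℕ) x => 1 / √(n : ℝ) * D.birkhoff φ ω n x) atTop
          (id : ℝ → ℝ) (fun _ => D.μ ω) (gaussianReal 0 V)) := by
  obtain ⟨V, hV⟩ := RandomCLT.RandomSystem.exists_ae_cltAt hs hp hr hD hφ_meas hφ_mean hφ_lip
    hφ_Lr hpr ha
  refine ⟨V, ?_, ?_⟩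
  · filter_upwards [hV] with ω hω using ⟨hω.integrable, hω.variance⟩
  · filter_upwards [hV] with ω hω using hω.clt
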